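/- **Setting.** Let $\Theta\subset\mathbb R^k$ be compact, $\Theta^\delta=\{\theta: d(\theta,\Theta)\le\delta\}$, $m:\Theta^\delta\to\mathbb R$ with random estimators $\widehat m=\widehat m_n$, and $\Theta_0=\{\theta\in\Theta: m(\theta)\le 0\}$, $\partial\Theta_0=\{\theta\in\Theta: m(\theta)=0\}\neq\emptyset$, $\widehat\Theta_{0,\delta}=\{\theta\in\Theta^\delta:\widehat m(\theta)\le 0\}$. Let $\widehat s$ and $\widehat w$ be random weighting functions. *Condition R* says that for some $\delta>0$: - (R.1) $\sqrt n(\widehat m-m)\rightsquigarrow \mathbb G$ in $\ell^\infty(\Theta^\delta)$, where $\mathbb G$ is a centred Gaussian process with a.s. continuous paths and $\inf_{\Theta^\delta}\mathrm E[\mathbb G(\theta)^2]>0$; - (R.2) $m$ and, almost surely, $\widehat m$ have continuous gradients on $\Theta^\delta$, $\nabla\widehat m=\nabla m+o_p(1)$ uniformly on $\Theta^\delta$, $\nabla m$ is Lipschitz and $\inf_{\Theta^\delta}\|\nabla m\|>0$; - (R.3) $\widehat s=s+o_p(1)$ and $\widehat w=w+o_p(1)$ uniformly on $\Theta^\delta$,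 where $s,w$ are continuous, positive and bounded away from zero. Let $H^*$ be the set of maps $\eta:\Theta^\delta\to\mathbb R^k$ that are one-to-one and continuously differentiable and for which Condition R holds with $\eta(\Theta)$, $m_\eta=m\circ\eta^{-1}$, $\widehat m_\eta=\widehat m\circ\eta^{-1}$, $\widehat s\circ\eta^{-1}$, $s\circ\eta^{-1}$ and $\widehat w(\eta^{-1}(\cdot);\eta)$ in place of $\Theta,m,\widehat m,\widehat s,s,\widehat w$ (for some expansion $\eta(\Theta)^{\delta'}\subset\eta(\Theta^\delta)$, $\delta'>0$, and some limiting weight). Here $\widehat w(\cdot;\eta)$ is the weighting function used with $\eta$, and $\widehat w(\theta)=\widehat w(\theta;\mathrm{id})$. For $\theta\in\Theta$ put $$\mathcal L_n(\theta)=\Big[\tfrac{\sqrt n\,\widehat m(\theta)}{\widehat s(\theta)}\Big]_+^2,\quad \mathcal L_n(\theta;\eta)=\Big[\tfrac{\sqrt n\,\widehat m_\eta(\eta(\theta))}{\widehat s(\theta)}\Big]_+^2,$$ $$\mathcal W_n(\theta)=\Big(\tfrac{\sqrt n\, d(\theta,\widehat\Theta_{0,\delta})}{\widehat w(\theta)}\Big)^2,\quad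 \mathcal W_n(\theta;\eta)=\Big(\tfrac{\sqrt n\, d(\eta(\theta),\eta(\widehat\Theta_{0,\delta}))}{\widehat w(\theta;\eta)}\Big)^2 .$$ Fix $0<\alpha<1/2$. The decision functions are $\phi_{Ln}(\theta)=\mathbf 1\{\mathcal L_n(\theta)\le\widehat k_L\}$, $\phi_{Ln}(\theta;\eta)=\mathbf 1\{\mathcal L_n(\theta;\eta)\le\widehat k_{L\eta}\}$, $\phi_{Wn}(\theta)=\mathbf 1\{\mathcal W_n(\theta)\le\widehat k_W\}$ and $\phi_{Wn}(\theta;\eta)=\mathbf 1\{\mathcal W_n(\theta;\eta)\le\widehat k_{W\eta}\}$. Here $\widehat k_L$, $\widehat k_W$ and (for $\eta\in H^*$) $\widehat k_{W\eta}$ are consistent estimators of the $(1-\alpha)$-quantiles of the limit laws of $\sup_{\Theta_0}\mathcal L_n(\theta)$, $\sup_{\Theta_0}\mathcal W_n(\theta)$ and $\sup_{\partial\Theta_0}\mathcal W_n(\theta;\eta)$, respectively. The values $\widehat k_L$ and $\widehat k_{L\eta}$ are obtained by applying one and the same rule to the random functions $\mathcal L_n(\cdot)$ and $\mathcal L_n(\cdot;\eta)$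 on $\Theta$. A decision function $\phi_n$ is *invariant* if $\phi_n(\theta)=\phi_n(\theta;\eta)$ for all $\theta\in\Theta$, $\eta\in H^*$, in every realization. It is *asymptotically invariant to first order* if $P(\phi_n(\theta_n)\ne\phi_n(\theta_n;\eta))\to0$ for all $\eta\in H^*$ and all sequences $\theta_n\in\Theta$ converging to a point of $\Theta$. It is *asymptotically similar on $\partial\Theta_0$* if for some constant $c\in(0,1)$ we have $\lim_n \mathrm E[\phi_n(\theta)]=c$ for every $\theta\in\partial\Theta_0$. **Proposition 3.** Suppose Condition R holds. In the statements on similarity suppose in addition that, on $\partial\Theta_0$, $s(\theta)$ is the standard deviation of $\mathbb G(\theta)$, up to a positive constant factor. 1. The LR-based decision function is invariant. Moreover, $\phi_{Ln}(\cdot)$ and, for each $\eta\in H^*$, $\phi_{Ln}(\cdot;\eta)$ are asymptotically similar on $\partial\Theta_0$. 2. Suppose there is a function $b(\theta)>0$ not depending on $\eta$ such that for all $\eta\in H^*$ and all $\theta\in\partial\Theta_0$ $$\widehat w(\theta;\eta)=\frac{b(\theta)}{\|\nabla_\eta m_\eta(\eta(\theta))\|}+o_p(1).$$ Then the W-based decision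 function is asymptotically invariant to first order. 3. If, for some constant $b>0$, $\widehat w(\theta;\eta)=b\,\widehat s(\theta)/\|\nabla_\eta m_\eta(\eta(\theta))\|+o_p(1)$ for all $\theta\in\partial\Theta_0$, then $\phi_{Wn}(\cdot;\eta)$ is asymptotically similar on $\partial\Theta_0$. This holds for each $\eta\in H^*$ and, with $\eta=\mathrm{id}$, for $\phi_{Wn}(\cdot)$. -/

import Mathlib

open MeasureTheory ProbabilityTheory Filter Topology Metric Set
open scoped ENNReal NNReal BoundedContinuousFunction

/-- The outer expectation `E*[h]` of a (possibly non-measurable) function `h ≥ 0`: the infimum of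
the integrals of its measurable majorants. -/
noncomputable def outerExpectation {Ω : Type*} [MeasurableSpace Ω] (P : Measure Ω)
    (h : Ω → ℝ≥0∞) : ℝ≥0∞ :=
  ⨅ (g : Ω → ℝ≥0∞) (_ : Measurable g) (_ : h ≤ g), ∫⁻ ω, g ω ∂P

/-- Weak convergence `X n ⇝ Y` in the sense of Hoffmann-Jørgensen: `E*[f (X n)] → E[f Y]` for every
bounded continuous `f`. (Nonnegative `f` suffice, since constants can be added to `f`.) No
measurability of `X n` is required. -/
def WeaklyConverges {Ω Ω' S : Type*} [MeasurableSpace Ω] [MeasurableSpace Ω'] [TopologicalSpace S]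
    (P : Measure Ω) (X : ℕ → Ω → S) (P' : Measure Ω') (Y : Ω' → S) : Prop :=
  ∀ f : S →ᵇ ℝ≥0,
    Tendsto (fun n => outerExpectation P (fun ω => (f (X n ω) : ℝ≥0∞))) atTop
      (𝓝 (∫⁻ ω', (f (Y ω') : ℝ≥0∞) ∂P'))

/-- `xhat = x + o_p(1)` uniformly over `D`. -/
def UniformlyConsistent {Ω E F : Type*} [MeasurableSpace Ω] [PseudoMetricSpace F]
    (P : Measure Ω) (D : Set E) (xhat : ℕ → Ω → E → F) (x : E → F) : Prop :=
  ∀ ε : ℝ, 0 < ε →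
    Tendsto (fun n => P {ω | ∃ θ ∈ D, ε ≤ dist (xhat n ω θ) (x θ)}) atTop (𝓝 0)

/-- The metric space `ℓ^∞(T)` of bounded real functions on `T` with the supremum norm. -/
abbrev LInfty (T : Type*) := lp (fun _ : T => ℝ) ∞

/-- Condition R.1 on the domain `D`: `√n (mhat - m) ⇝ G` in `ℓ^∞(D)`, where `G` is a centred
Gaussian process with almost surely continuous paths and variance bounded away from zero. -/
structure ConditionR1 {Ω Ω' E : Type*} [MeasurableSpace Ω] [MeasurableSpace Ω']
    [TopologicalSpace E] (P : Measure Ω) (P' : Measure Ω') (D : Set E)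
    (m : E → ℝ) (mhat : ℕ → Ω → E → ℝ) (G : E → Ω' → ℝ) : Prop where
  gaussian : IsGaussianProcess (fun θ : D => G θ) P'
  centered : ∀ θ ∈ D, ∫ ω', G θ ω' ∂P' = 0
  continuous_paths : ∀ᵐ ω' ∂P', ContinuousOn (fun θ => G θ ω') D
  nondegenerate : ∃ c : ℝ, 0 < c ∧ ∀ θ ∈ D, c ≤ ∫ ω', (G θ ω') ^ 2 ∂P'
  weak_limit : ∃ (X : ℕ → Ω → LInfty D) (Y : Ω' → LInfty D),
    (∀ n, ∀ᵐ ω ∂P, ∀ θ : D, X n ω θ = √(n : ℝ) * (mhat n ω θ - m θ)) ∧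
    (∀ᵐ ω' ∂P', ∀ θ : D, Y ω' θ = G θ ω') ∧
    WeaklyConverges P X P' Y

/-- Condition R.2 on the domain `D`: `m` and, almost surely, `mhat` have continuous gradients on
`D`; these are uniformly consistent; the gradient of `m` is Lipschitz and bounded away from
zero. -/
structure ConditionR2 {Ω E : Type*} [MeasurableSpace Ω] [NormedAddCommGroup E]
    [InnerProductSpace ℝ E] [CompleteSpace E] (P : Measure Ω) (D : Set E)
    (m : E → ℝ) (mhat : ℕ → Ω → E → ℝ) : Prop where
  differentiable : DifferentiableOn ℝ m D
  continuous_gradient : ContinuousOn (gradientWithin m D) D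
  differentiable_hat : ∀ n, ∀ᵐ ω ∂P, DifferentiableOn ℝ (mhat n ω) D
  continuous_gradient_hat : ∀ n, ∀ᵐ ω ∂P, ContinuousOn (gradientWithin (mhat n ω) D) D
  consistent : UniformlyConsistent P D (fun n ω => gradientWithin (mhat n ω) D)
    (gradientWithin m D)
  lipschitz : ∃ L : ℝ≥0, LipschitzOnWith L (gradientWithin m D) D
  gradient_bound : ∃ c : ℝ, 0 < c ∧ ∀ θ ∈ D, c ≤ ‖gradientWithin m D θ‖

/-- Condition R.3 on the domain `D`, for one weighting function: `shat = s + o_p(1)` uniformly,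
with `s` continuous, positive and bounded away from zero. -/
structure ConditionR3 {Ω E : Type*} [MeasurableSpace Ω] [TopologicalSpace E]
    (P : Measure Ω) (D : Set E) (s : E → ℝ) (shat : ℕ → Ω → E → ℝ) : Prop where
  consistent : UniformlyConsistent P D shat s
  continuous : ContinuousOn s D
  bound : ∃ c : ℝ, 0 < c ∧ ∀ θ ∈ D, c ≤ s θ

/-- Conditions R.1-R.3 for the parameter space `Θ`, on its `δ`-expansion
`{θ | d(θ, Θ) ≤ δ} = cthickening δ Θ`. -/
structure ConditionR {Ω Ω' E : Type*} [MeasurableSpace Ω] [MeasurableSpace Ω']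
    [NormedAddCommGroup E] [InnerProductSpace ℝ E] [CompleteSpace E]
    (P : Measure Ω) (P' : Measure Ω') (Θ : Set E) (δ : ℝ)
    (m : E → ℝ) (mhat : ℕ → Ω → E → ℝ) (s : E → ℝ) (shat : ℕ → Ω → E → ℝ)
    (w : E → ℝ) (what : ℕ → Ω → E → ℝ) (G : E → Ω' → ℝ) : Prop where
  pos : 0 < δ
  r1 : ConditionR1 P P' (cthickening δ Θ) m mhat G
  r2 : ConditionR2 P (cthickening δ Θ) m mhat
  r3_s : ConditionR3 P (cthickening δ Θ) s shat
  r3_w : ConditionR3 P (cthickening δ Θ) w what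

/-- The transformed function `f_η = f ∘ η⁻¹`, for `η` injective on `D`; it is meaningful on
`η '' D`. -/
noncomputable def transformed {E F : Type*} [Nonempty E] (D : Set E) (η : E → E) (f : E → F) :
    E → F :=
  fun υ => f (Function.invFunOn η D υ)

/-- The set `H*` of parameter transformations: maps `η` that are one-to-one and continuously
differentiable on the `δ`-expansion of `Θ` and for which Conditions R.1-R.3 hold for the
transformed moments `m_η`, `mhat_η` and weights, on some expansion of the transformed parameter
space `η '' Θ` on which these functions are well-defined. `what η` is the weighting function
`ŵ(·;η)` used with the transformation `η`. -/
def admissibleTransformations {Ω Ω' E : Type*} [MeasurableSpace Ω] [MeasurableSpace Ω']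
    [NormedAddCommGroup E] [InnerProductSpace ℝ E] [CompleteSpace E]
    (P : Measure Ω) (P' : Measure Ω') (Θ : Set E) (δ : ℝ)
    (m : E → ℝ) (mhat : ℕ → Ω → E → ℝ) (s : E → ℝ) (shat : ℕ → Ω → E → ℝ)
    (what : (E → E) → ℕ → Ω → E → ℝ) : Set (E → E) :=
  {η | InjOn η (cthickening δ Θ) ∧ ContDiffOn ℝ 1 η (cthickening δ Θ) ∧
    ∃ (δ' : ℝ) (w' : E → ℝ) (G' : E → Ω' → ℝ),
      cthickening δ' (η '' Θ) ⊆ η '' (cthickening δ Θ) ∧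
      ConditionR P P' (η '' Θ) δ'
        (transformed (cthickening δ Θ) η m)
        (fun n ω => transformed (cthickening δ Θ) η (mhat n ω))
        (transformed (cthickening δ Θ) η s)
        (fun n ω => transformed (cthickening δ Θ) η (shat n ω))
        w'
        (fun n ω => transformed (cthickening δ Θ) η (what η n ω)) G'}

/-- The identified set `Θ₀ = {θ ∈ Θ | m θ ≤ 0}`. -/
def identifiedSet {E : Type*} (Θ : Set E) (m : E → ℝ) : Set E := {θ ∈ Θ | m θ ≤ 0}

/-- The boundary `∂Θ₀ = {θ ∈ Θ | m θ = 0}` of the identified set. -/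
def identifiedBoundary {E : Type*} (Θ : Set E) (m : E → ℝ) : Set E := {θ ∈ Θ | m θ = 0}

/-- `𝓛_n(θ) = [√n mhat(θ) / shat(θ)]₊²`. -/
noncomputable def lrStat {Ω E : Type*} (mhat shat : ℕ → Ω → E → ℝ) (n : ℕ) (ω : Ω) (θ : E) : ℝ :=
  (max (√(n : ℝ) * mhat n ω θ / shat n ω θ) 0) ^ 2

/-- `𝓛_n(θ;η) = [√n mhat_η(η(θ)) / shat(θ)]₊²`, with `D` the domain of `η`. -/
noncomputable def lrStatT {Ω E : Type*} [Nonempty E] (D : Set E) (mhat shat : ℕ → Ω → E → ℝ)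
    (η : E → E) (n : ℕ) (ω : Ω) (θ : E) : ℝ :=
  (max (√(n : ℝ) * transformed D η (mhat n ω) (η θ) / shat n ω θ) 0) ^ 2

/-- `𝓦_n(θ) = (√n d(θ, Θhat) / what(θ))²`, where `Θhat = {θ ∈ D | mhat(θ) ≤ 0}` and `D` is the
expansion of the parameter space. -/
noncomputable def waldStat {Ω E : Type*} [PseudoMetricSpace E] (D : Set E)
    (mhat what : ℕ → Ω → E → ℝ) (n : ℕ) (ω : Ω) (θ : E) : ℝ :=
  (√(n : ℝ) * infDist θ (identifiedSet D (mhat n ω)) / what n ω θ) ^ 2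

/-- `𝓦_n(θ;η) = (√n d(η(θ), η(Θhat)) / ŵ(θ;η))²`, where `Θhat = {θ ∈ D | mhat(θ) ≤ 0}`. -/
noncomputable def waldStatT {Ω E : Type*} [PseudoMetricSpace E] (D : Set E)
    (mhat : ℕ → Ω → E → ℝ) (what : (E → E) → ℕ → Ω → E → ℝ) (η : E → E)
    (n : ℕ) (ω : Ω) (θ : E) : ℝ :=
  (√(n : ℝ) * infDist (η θ) (η '' identifiedSet D (mhat n ω)) / what η n ω θ) ^ 2

/-- `sup_{θ ∈ A} stat_n(θ)`. -/
noncomputable def supStat {Ω E : Type*} (A : Set E) (stat : ℕ → Ω → E → ℝ) (n : ℕ) (ω : Ω) : ℝ :=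
  sSup (stat n ω '' A)

/-- The decision function `φ_n(θ) = 1{stat_n(θ) ≤ k_n}`. -/
noncomputable def decision {Ω E : Type*} (stat : ℕ → Ω → E → ℝ) (k : ℕ → Ω → ℝ)
    (n : ℕ) (ω : Ω) (θ : E) : ℝ :=
  open Classical in if stat n ω θ ≤ k n ω then 1 else 0

/-- `q` is the asymptotic `p`-quantile of `X n`: the `p`-quantile of the limit law of `X n`. -/
def IsAsymptoticQuantile {Ω : Type*} [MeasurableSpace Ω] (P : Measure Ω) (X : ℕ → Ω → ℝ)
    (p q : ℝ) : Prop :=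
  ∃ μ : Measure ℝ, IsProbabilityMeasure μ ∧ WeaklyConverges P X μ id ∧
    q = sInf {x : ℝ | p ≤ cdf μ x}

/-- `k n` is a consistent estimator of the asymptotic `p`-quantile of `X n`. -/
def EstimatesAsymptoticQuantile {Ω : Type*} [MeasurableSpace Ω] (P : Measure Ω)
    (k : ℕ → Ω → ℝ) (X : ℕ → Ω → ℝ) (p : ℝ) : Prop :=
  ∀ q : ℝ, IsAsymptoticQuantile P X p q → TendstoInMeasure P k atTop (fun _ => q)

/-- (Exact) invariance on `Θ` of decision functions `φ` with transformed versions `φT η`, with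
respect to the transformations in `H`. -/
def Invariant {Ω E : Type*} (Θ : Set E) (H : Set (E → E)) (φ : ℕ → Ω → E → ℝ)
    (φT : (E → E) → ℕ → Ω → E → ℝ) : Prop :=
  ∀ η ∈ H, ∀ θ ∈ Θ, ∀ n ω, φ n ω θ = φT η n ω θ

/-- Asymptotic invariance to first order: `P(φ_n(θ_n) ≠ φ_n(θ_n;η)) → 0` for all `η ∈ H` and all
sequences `θ_n` in `Θ` that converge to some `θ₀ ∈ Θ`. -/
def AsymptoticallyInvariant {Ω E : Type*} [MeasurableSpace Ω] [TopologicalSpace E]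
    (P : Measure Ω) (Θ : Set E) (H : Set (E → E)) (φ : ℕ → Ω → E → ℝ)
    (φT : (E → E) → ℕ → Ω → E → ℝ) : Prop :=
  ∀ η ∈ H, ∀ θ₀ ∈ Θ, ∀ θseq : ℕ → E, (∀ n, θseq n ∈ Θ) → Tendsto θseq atTop (𝓝 θ₀) →
    Tendsto (fun n => P {ω | φ n ω (θseq n) ≠ φT η n ω (θseq n)}) atTop (𝓝 0)

/-- Asymptotic similarity on `B`: `E[φ_n(θ)] → c` for some `c ∈ (0,1)` that is the same for all
`θ ∈ B`. As `φ_n` takes the values 0 and 1 only, its expectation is `P(φ_n(θ) = 1)`. -/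
def AsymptoticallySimilar {Ω E : Type*} [MeasurableSpace Ω] (P : Measure Ω) (B : Set E)
    (φ : ℕ → Ω → E → ℝ) : Prop :=
  ∃ c : ℝ, 0 < c ∧ c < 1 ∧ ∀ θ ∈ B,
    Tendsto (fun n => P {ω | φ n ω θ = 1}) atTop (𝓝 (ENNReal.ofReal c))

/-- On `B`, the limiting weight `s` is, up to a positive constant, the standard deviation of the
centred process `G`. -/
def IsStandardDeviationWeight {Ω' E : Type*} [MeasurableSpace Ω'] (P' : Measure Ω') (B : Set E)
    (s : E → ℝ) (G : E → Ω' → ℝ) : Prop :=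
  ∃ c : ℝ, 0 < c ∧ ∀ θ ∈ B, s θ = c * √(∫ ω', (G θ ω') ^ 2 ∂P')

/-- `ŵ(θ;η) = t_n(θ) / ‖∇_η m_η(η(θ))‖ + o_p(1)` for every `θ ∈ B`. -/
def HasWeightForm {Ω E : Type*} [MeasurableSpace Ω] [NormedAddCommGroup E]
    [InnerProductSpace ℝ E] [CompleteSpace E] (P : Measure Ω) (D B : Set E) (m : E → ℝ)
    (what : (E → E) → ℕ → Ω → E → ℝ) (η : E → E) (t : ℕ → Ω → E → ℝ) : Prop :=
  ∀ θ ∈ B, TendstoInMeasure P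
    (fun n ω => what η n ω θ - t n ω θ / ‖gradient (transformed D η m) (η θ)‖) atTop (fun _ => 0)

/-! The LR part is exact: the transformed moment at η(θ) is `mhat` at θ, so both LR statistics are
the same function on `Θ`, and one rule turns them into one critical value.

The Wald statistic is compared with the moment itself. On a ball of fixed radius around a point of
`Θ` the gradient of `mhat` is nearly constant, so where `mhat θ` is small the distance to the
estimated set is [mhat(θ)]₊ / ‖∇m(θ)‖ up to a factor near one (`infDist_sublevel_bounds`). Hence the
square root of each statistic is √n [mhat(θ)]₊ / b(θ) up to a factor 1 + o_p(1) (`RatioApprox`).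
Here b is `s` for LR, and for Wald the limiting weight times the gradient norm, both in
η-coordinates (`exists_waldStatT_weight`). To first order the parametrization enters through b
alone, and the weight condition determines b on ∂Θ₀.

Suprema over any set between ∂Θ₀ and Θ₀ converge to the supremum of ([G]₊/b)² over ∂Θ₀: away from
∂Θ₀ the drift √n m kills the score, near it equicontinuity applies (`tendsto_sqrt_supStat_sub`). So
the critical values converge to some q that depends on b only through ∂Θ₀, and q > 0 because α < 1/2
(`tendsto_criticalValue`).

Similarity: if b is proportional to the standard deviation of G, then ([G(θ)]₊/b(θ))² has the same
law at every boundary point (`asymptoticallySimilar_decision`). Invariance: along θ_n → θ₀ both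
statistics vanish if m(θ₀) < 0 and both diverge if m(θ₀) > 0. If m(θ₀) = 0, decisions can differ
only when √n mhat(θ_n) falls close to b(θ₀)√q, and the Gaussian limit makes short intervals
improbable, uniformly in their location (`eventually_decision_eq`, `exists_concentration_lt`).

Nothing requires the estimators to be measurable, so probabilities are outer ones, and "with
probability tending to one" is the filter `inProb`. Tightness in the space ℓ^∞ comes from the
continuous paths of the limit: C(D, ℝ) is separable for compact D
(`WeaklyConverges.exists_finset_net`). -/

/-! ### Convergence in outer probability as a filter -/

/-- The filter on `ℕ × Ω` of the sequences of events whose complements have outer probability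
tending to zero. -/
def inProb {Ω : Type*} [MeasurableSpace Ω] (P : Measure Ω) : Filter (ℕ × Ω) where
  sets := {A | Tendsto (fun n => P {ω | (n, ω) ∉ A}) atTop (𝓝 0)}
  univ_sets := by simp
  sets_of_superset := by
    intro A B hA hAB
    exact tendsto_of_tendsto_of_tendsto_of_le_of_le tendsto_const_nhds hA (fun _ => zero_le)
      fun n => measure_mono fun ω hω h => hω (hAB h)
  inter_sets := by
    intro A B hA hB
    have h : Tendsto (fun n => P {ω | (n, ω) ∉ A} + P {ω | (n, ω) ∉ B}) atTop (𝓝 0) := by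
      simpa using Tendsto.add (show Tendsto _ _ _ from hA) (show Tendsto _ _ _ from hB)
    refine tendsto_of_tendsto_of_tendsto_of_le_of_le tendsto_const_nhds h (fun _ => zero_le)
      fun n => le_trans (measure_mono ?_) (measure_union_le _ _)
    intro ω hω
    simpa [not_and_or, imp_iff_not_or] using hω

section InProb

variable {Ω : Type*} [MeasurableSpace Ω] {P : Measure Ω}

lemma eventually_inProb_iff {C : ℕ × Ω → Prop} :
    (∀ᶠ p in inProb P, C p) ↔ Tendsto (fun n => P {ω | ¬ C (n, ω)}) atTop (𝓝 0) := Iff.rfl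

lemma eventually_inProb_of_ae {C : ℕ × Ω → Prop}
    (h : ∀ᶠ n in atTop, ∀ᵐ ω ∂P, C (n, ω)) : ∀ᶠ p in inProb P, C p := by
  rw [eventually_inProb_iff]
  refine tendsto_const_nhds.congr' ?_
  filter_upwards [h] with n hn
  exact (ae_iff.1 hn).symm

lemma tendsto_fst_inProb : Tendsto Prod.fst (inProb P) atTop := by
  intro A hA
  exact eventually_inProb_of_ae (C := fun p => p.1 ∈ A)
    ((show ∀ᶠ n in atTop, n ∈ A from hA).mono fun n hn => ae_of_all _ fun _ => hn)

/-- Gives uniqueness of limits in probability, by which the limiting weights are identified. -/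
instance inProb_neBot [IsProbabilityMeasure P] : (inProb P).NeBot := by
  refine ⟨fun h => ?_⟩
  have h1 : Tendsto (fun n : ℕ => P {ω | (n, ω) ∉ (∅ : Set (ℕ × Ω))}) atTop (𝓝 0) :=
    empty_mem_iff_bot.2 h
  simp at h1

lemma eventually_measure_le_of_imp {A C : ℕ × Ω → Prop} {ε : ℝ≥0∞} (hε : 0 < ε)
    (hA : ∀ᶠ n in atTop, P {ω | ¬ A (n, ω)} ≤ ε / 2) (hC : ∀ᶠ p in inProb P, A p → C p) :
    ∀ᶠ n in atTop, P {ω | ¬ C (n, ω)} ≤ ε := by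
  have hC' := (eventually_inProb_iff.1 hC).eventually_le_const (ENNReal.half_pos hε.ne')
  filter_upwards [hA, hC'] with n hn hn'
  calc P {ω | ¬ C (n, ω)} ≤ P ({ω | ¬ A (n, ω)} ∪ {ω | ¬ (A (n, ω) → C (n, ω))}) :=
        measure_mono fun ω hω => by
          by_cases h : A (n, ω)
          · exact Or.inr fun h' => hω (h' h)
          · exact Or.inl h
    _ ≤ ε / 2 + ε / 2 := (measure_union_le _ _).trans (add_le_add hn hn')
    _ = ε := ENNReal.add_halves ε

/-- Tightness only provides events of probability at least 1 - ε for each fixed ε. It is enough to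
argue on each of these. -/
lemma eventually_inProb_of_forall {C : ℕ × Ω → Prop}
    (h : ∀ ε : ℝ≥0∞, 0 < ε → ∃ A : ℕ × Ω → Prop, (∀ᶠ n in atTop, P {ω | ¬ A (n, ω)} ≤ ε) ∧
      ∀ᶠ p in inProb P, A p → C p) : ∀ᶠ p in inProb P, C p := by
  rw [eventually_inProb_iff, ENNReal.tendsto_atTop_zero]
  intro ε hε
  obtain ⟨A, hA, hC⟩ := h (ε / 2) (ENNReal.half_pos hε.ne')
  exact eventually_atTop.1 (eventually_measure_le_of_imp hε hA hC)

lemma MeasureTheory.TendstoInMeasure.tendsto_inProb {k : ℕ → Ω → ℝ} {q : ℝ}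
    (h : TendstoInMeasure P k atTop fun _ => q) :
    Tendsto (fun p : ℕ × Ω => k p.1 p.2) (inProb P) (𝓝 q) := by
  rw [EMetric.tendsto_nhds]
  intro ε hε
  rw [eventually_inProb_iff]
  simpa using h ε hε

lemma UniformlyConsistent.eventually {E F : Type*} [PseudoMetricSpace F] {D : Set E}
    {xhat : ℕ → Ω → E → F} {x : E → F} (h : UniformlyConsistent P D xhat x) {ε : ℝ} (hε : 0 < ε) :
    ∀ᶠ p in inProb P, ∀ θ ∈ D, dist (xhat p.1 p.2 θ) (x θ) < ε := by
  rw [eventually_inProb_iff]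
  simpa using h ε hε

end InProb

/-! ### Outer expectations and weak convergence -/

section Weak

variable {Ω Ω' S : Type*} [MeasurableSpace Ω] [MeasurableSpace Ω'] {P : Measure Ω}
  {P' : Measure Ω'}

lemma measure_le_outerExpectation {h : Ω → ℝ≥0∞} {A : Set Ω} (hA : ∀ ω ∈ A, 1 ≤ h ω) :
    P A ≤ outerExpectation P h := by
  refine le_iInf fun g => le_iInf fun hg => le_iInf fun hgh => ?_
  calc P A ≤ P {ω | 1 ≤ g ω} := measure_mono fun ω hω => (hA ω hω).trans (hgh ω)
    _ ≤ ∫⁻ ω, g ω ∂P := by simpa using mul_meas_ge_le_lintegral hg 1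

/-- The exceptional set may fail to be measurable. Its measurable hull has the same measure and
makes g + c + K·1 a measurable majorant. -/
lemma outerExpectation_le_add [IsProbabilityMeasure P] {h₁ h₂ : Ω → ℝ≥0∞} {A : Set Ω}
    {c K : ℝ≥0∞} (hA : ∀ ω ∉ A, h₁ ω ≤ h₂ ω + c) (hK : ∀ ω, h₁ ω ≤ K) :
    outerExpectation P h₁ ≤ outerExpectation P h₂ + (c + K * P A) := by
  rw [← tsub_le_iff_right]
  refine le_iInf fun g => le_iInf fun hg => le_iInf fun hgh => ?_
  rw [tsub_le_iff_right]
  have hm : Measurable ((toMeasurable P A).indicator fun _ => K) :=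
    measurable_const.indicator (measurableSet_toMeasurable P A)
  calc outerExpectation P h₁
      ≤ ∫⁻ ω, g ω + (c + (toMeasurable P A).indicator (fun _ => K) ω) ∂P := by
        refine iInf_le_of_le _ (iInf_le_of_le (hg.add (measurable_const.add hm))
          (iInf_le_of_le (fun ω => ?_) le_rfl))
        by_cases hω : ω ∈ toMeasurable P A
        · exact (hK ω).trans (le_add_left (le_add_left (by rw [indicator_of_mem hω])))
        · refine (hA ω fun h => hω (subset_toMeasurable P A h)).trans ?_
          exact add_le_add (hgh ω) le_self_add
    _ = ∫⁻ ω, g ω ∂P + (c + K * P A) := by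
        rw [lintegral_add_left hg, lintegral_add_left measurable_const,
          lintegral_indicator (measurableSet_toMeasurable P A)]
        simp

lemma WeaklyConverges.comp {T : Type*} [TopologicalSpace S] [TopologicalSpace T]
    {X : ℕ → Ω → S} {Y : Ω' → S} (h : WeaklyConverges P X P' Y) {φ : S → T} (hφ : Continuous φ) :
    WeaklyConverges P (fun n ω => φ (X n ω)) P' (fun ω' => φ (Y ω')) :=
  fun f => h (f.compContinuous ⟨φ, hφ⟩)

lemma WeaklyConverges.map [TopologicalSpace S] [MeasurableSpace S] [OpensMeasurableSpace S]
    {X : ℕ → Ω → S} {Y : Ω' → S} (h : WeaklyConverges P X P' Y) (hY : AEMeasurable Y P') :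
    WeaklyConverges P X (P'.map Y) id := by
  intro f
  rw [lintegral_map' (f := fun x => ((f (id x) : ℝ≥0) : ℝ≥0∞))
    (by simpa using f.continuous.measurable.coe_nnreal_ennreal.aemeasurable) hY]
  exact h f

/-- The portmanteau inequality for closed sets. -/
lemma WeaklyConverges.eventually_lt_of_isClosed [PseudoEMetricSpace S] [MeasurableSpace S]
    [OpensMeasurableSpace S] [IsFiniteMeasure P'] {X : ℕ → Ω → S} {Y : Ω' → S}
    (h : WeaklyConverges P X P' Y) (hY : AEMeasurable Y P') {F : Set S} (hF : IsClosed F)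
    {c : ℝ≥0∞} (hc : P' (Y ⁻¹' F) < c) : ∀ᶠ n in atTop, P (X n ⁻¹' F) < c := by
  rw [← Measure.map_apply_of_aemeasurable hY hF.measurableSet] at hc
  have hpos : ∀ n : ℕ, (0 : ℝ) < 1 / ((n : ℝ) + 1) := fun n => Nat.one_div_pos_of_nat
  have h1 := (tendsto_lintegral_thickenedIndicator_of_isClosed (P'.map Y) hF hpos
    tendsto_one_div_add_atTop_nhds_zero_nat).eventually_lt_const hc
  obtain ⟨k, hk⟩ := h1.exists
  have h2 := (h.map hY (thickenedIndicator (hpos k) F)).eventually_lt_const hk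
  filter_upwards [h2] with n hn
  refine (measure_le_outerExpectation fun ω hω => ?_).trans_lt hn
  rw [thickenedIndicator_one (hpos k) F (show X n ω ∈ F from hω), ENNReal.coe_one]

/-- The closed-set inequality for (-∞, q] bounds the limit from above. For [q, ∞) it bounds it from
below, since the two half-lines cover ℝ and outer measure is subadditive; no measurability of `U n`
enters. -/
lemma WeaklyConverges.tendsto_measure_le [IsProbabilityMeasure P] [IsProbabilityMeasure P']
    {U : ℕ → Ω → ℝ} {V : Ω' → ℝ} (h : WeaklyConverges P U P' V) (hV : AEMeasurable V P') {q : ℝ}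
    (hq : P' {ω | V ω = q} = 0) :
    Tendsto (fun n => P {ω | U n ω ≤ q}) atTop (𝓝 (P' {ω | V ω ≤ q})) := by
  rw [tendsto_order]
  refine ⟨fun c hc => ?_, fun c hc => h.eventually_lt_of_isClosed hV isClosed_Iic hc⟩
  have hn : NullMeasurableSet {ω | V ω ≤ q} P' := hV.nullMeasurable measurableSet_Iic
  have h1 : P' (V ⁻¹' Ici q) = 1 - P' {ω | V ω ≤ q} := by
    rw [← prob_compl_eq_one_sub₀ hn]
    apply le_antisymm
    · calc P' (V ⁻¹' Ici q) ≤ P' ({ω | V ω ≤ q}ᶜ ∪ {ω | V ω = q}) := measure_mono fun ω hω => by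
            rcases (show q ≤ V ω from hω).lt_or_eq with h | h
            · exact Or.inl (not_le.2 h)
            · exact Or.inr h.symm
        _ ≤ _ := (measure_union_le _ _).trans (by simp [hq])
    · exact measure_mono fun ω hω => (not_le.1 (show ¬ V ω ≤ q from hω)).le
  have h2 : P' (V ⁻¹' Ici q) < 1 - c := by
    rw [h1]
    rw [lt_tsub_iff_right]
    calc 1 - P' {ω | V ω ≤ q} + c < 1 - P' {ω | V ω ≤ q} + P' {ω | V ω ≤ q} :=
          ENNReal.add_lt_add_left (by simp) hc
      _ = 1 := tsub_add_cancel_of_le prob_le_one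
  filter_upwards [h.eventually_lt_of_isClosed hV isClosed_Ici h2] with n hn
  have h3 : 1 ≤ P {ω | U n ω ≤ q} + P (U n ⁻¹' Ici q) := by
    rw [← measure_univ (μ := P)]
    refine (measure_mono fun ω _ => ?_).trans (measure_union_le _ _)
    exact le_total (U n ω) q
  by_contra! hle
  have hc1 : c ≤ 1 := hc.le.trans prob_le_one
  have : P {ω | U n ω ≤ q} + P (U n ⁻¹' Ici q) < c + (1 - c) :=
    ENNReal.add_lt_add_of_le_of_lt (hle.trans_lt (hc1.trans_lt ENNReal.one_lt_top)).ne hle hn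
  rw [add_tsub_cancel_of_le hc1] at this
  exact absurd h3 (not_le.2 this)

lemma exists_measure_abs_ge_lt [IsFiniteMeasure P'] {V : Ω' → ℝ} (hV : AEMeasurable V P')
    {ε : ℝ≥0∞} (hε : 0 < ε) : ∃ M : ℝ, 0 < M ∧ P' {ω | M ≤ |V ω|} < ε := by
  have h : Tendsto (fun n : ℕ => P' {ω | (n : ℝ) ≤ |V ω|}) atTop
      (𝓝 (P' (⋂ n : ℕ, {ω | (n : ℝ) ≤ |V ω|}))) := by
    refine tendsto_measure_iInter_atTop (fun n => ?_) ?_ ⟨0, measure_ne_top _ _⟩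
    · exact (hV.norm.nullMeasurable measurableSet_Ici :)
    · intro a b hab ω hω
      exact (Nat.cast_le.2 hab).trans (show (b : ℝ) ≤ |V ω| from hω)
  have h0 : (⋂ n : ℕ, {ω | (n : ℝ) ≤ |V ω|}) = ∅ := by
    refine eq_empty_of_forall_notMem fun ω hω => ?_
    obtain ⟨n, hn⟩ := exists_nat_gt |V ω|
    exact absurd (mem_iInter.1 hω n) (not_le.2 hn)
  rw [h0, measure_empty] at h
  obtain ⟨n, hn, hn1⟩ := ((h.eventually_lt_const hε).and (eventually_ge_atTop 1)).exists
  exact ⟨n, by exact_mod_cast hn1, hn⟩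

/-- Slutsky's theorem. -/
lemma WeaklyConverges.of_tendsto_sub [IsProbabilityMeasure P] [IsProbabilityMeasure P']
    {U T : ℕ → Ω → ℝ} {V : Ω' → ℝ} (h : WeaklyConverges P U P' V) (hV : AEMeasurable V P')
    (hT : Tendsto (fun p : ℕ × Ω => T p.1 p.2 - U p.1 p.2) (inProb P) (𝓝 0)) :
    WeaklyConverges P T P' V := by
  intro f
  obtain ⟨C, hC⟩ := f.bounded
  set K : ℝ≥0 := f 0 + C.toNNReal with hK
  have hfK : ∀ x, (f x : ℝ≥0∞) ≤ K := fun x => by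
    rw [ENNReal.coe_le_coe, hK, ← NNReal.coe_le_coe]
    have := (abs_le.1 ((NNReal.dist_eq _ _).symm.le.trans (hC x 0))).2
    push_cast
    linarith [Real.le_coe_toNNReal C]
  have hclose : ∀ ε : ℝ, 0 < ε →
      ∀ᶠ p in inProb P, dist (f (T p.1 p.2)) (f (U p.1 p.2)) < ε := by
    intro ε hε
    refine eventually_inProb_of_forall fun ε' hε' => ?_
    obtain ⟨M, hM, hMε⟩ := exists_measure_abs_ge_lt hV hε'
    refine ⟨fun p => |U p.1 p.2| < M, ?_, ?_⟩
    · have := h.eventually_lt_of_isClosed hV (F := {x | M ≤ |x|})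
        (isClosed_le continuous_const continuous_abs) hMε
      filter_upwards [this] with n hn
      refine le_trans (measure_mono fun ω hω => ?_) hn.le
      exact not_lt.1 hω
    -- f is uniformly continuous only on compact sets. With |U| < M and |T - U| < 1 both values lie
    -- in [-(M+1), M+1].
    · have hu := (isCompact_Icc (a := -(M + 1)) (b := M + 1)).uniformContinuousOn_of_continuous
        f.continuous.continuousOn
      obtain ⟨r, hr, hru⟩ := Metric.uniformContinuousOn_iff.1 hu ε hε
      have h1 := Metric.tendsto_nhds.1 hT (min r 1) (by positivity)
      filter_upwards [h1] with p hp hU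
      rw [Real.dist_eq, sub_zero, lt_min_iff] at hp
      rw [abs_lt] at hU
      have := abs_lt.1 hp.2
      refine hru _ ⟨by linarith, by linarith⟩ _ ⟨by linarith, by linarith⟩ hp.1
  have hdiff : ∀ ε : ℝ≥0∞, 0 < ε → ∀ᶠ n in atTop,
      outerExpectation P (fun ω => (f (T n ω) : ℝ≥0∞)) ≤
        outerExpectation P (fun ω => (f (U n ω) : ℝ≥0∞)) + ε ∧
      outerExpectation P (fun ω => (f (U n ω) : ℝ≥0∞)) ≤
        outerExpectation P (fun ω => (f (T n ω) : ℝ≥0∞)) + ε := by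
    intro ε hε
    obtain ⟨e, he0, he⟩ := ENNReal.lt_iff_exists_nnreal_btwn.1 (ENNReal.half_pos hε.ne')
    have he0' : (0 : ℝ) < e := by exact_mod_cast he0
    have h1 := hclose e he0'
    rw [eventually_inProb_iff] at h1
    have h2 : Tendsto (fun n => (K : ℝ≥0∞) * P {ω | ¬ dist (f (T n ω)) (f (U n ω)) < e}) atTop
        (𝓝 0) := by
      simpa using ENNReal.Tendsto.const_mul h1 (Or.inr ENNReal.coe_ne_top)
    filter_upwards [h2.eventually_lt_const (ENNReal.half_pos hε.ne')] with n hn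
    have hle : (e : ℝ≥0∞) + K * P {ω | ¬ dist (f (T n ω)) (f (U n ω)) < e} ≤ ε :=
      (add_le_add he.le hn.le).trans (ENNReal.add_halves ε).le
    constructor
    · refine (outerExpectation_le_add (c := e) (K := K)
        (A := {ω | ¬ dist (f (T n ω)) (f (U n ω)) < e}) (fun ω hω => ?_)
        fun ω => hfK _).trans (by gcongr)
      have := not_not.1 hω
      rw [NNReal.dist_eq, abs_lt] at this
      rw [← ENNReal.coe_add, ENNReal.coe_le_coe, ← NNReal.coe_le_coe]
      push_cast
      linarith
    · refine (outerExpectation_le_add (c := e) (K := K)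
        (A := {ω | ¬ dist (f (T n ω)) (f (U n ω)) < e}) (fun ω hω => ?_)
        fun ω => hfK _).trans (by gcongr)
      have := not_not.1 hω
      rw [NNReal.dist_eq, abs_lt] at this
      rw [← ENNReal.coe_add, ENNReal.coe_le_coe, ← NNReal.coe_le_coe]
      push_cast
      linarith
  have hL : ∫⁻ ω', (f (V ω') : ℝ≥0∞) ∂P' ≠ ∞ := by
    refine ((lintegral_mono fun ω' => hfK _).trans_lt ?_).ne
    simp
  rw [ENNReal.tendsto_nhds hL]
  intro ε hε
  have hε2 := ENNReal.half_pos hε.ne'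
  filter_upwards [hdiff _ hε2, (ENNReal.tendsto_nhds hL).1 (h f) _ hε2] with n hn hn'
  constructor
  · rw [tsub_le_iff_right]
    calc _ ≤ outerExpectation P (fun ω => (f (U n ω) : ℝ≥0∞)) + ε / 2 :=
          tsub_le_iff_right.1 hn'.1
      _ ≤ _ := by
          rw [← ENNReal.add_halves ε, ← add_assoc, ENNReal.add_halves]
          gcongr
          exact hn.2
  · calc _ ≤ _ := hn.1
      _ ≤ _ + ε / 2 + ε / 2 := by
          gcongr
          exact hn'.2
      _ = _ := by rw [add_assoc, ENNReal.add_halves]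

end Weak

/-! ### Continuous functions inside `ℓ^∞` -/

section Tightness

variable {T : Type*} [TopologicalSpace T] [CompactSpace T]

/-- The embedding of `C(T, ℝ)` into `ℓ^∞(T)`. -/
def ContinuousMap.toLInfty (f : C(T, ℝ)) : LInfty T :=
  ⟨fun t => f t, memℓp_infty ⟨‖f‖, by rintro _ ⟨t, rfl⟩; exact f.norm_coe_le_norm t⟩⟩

@[simp] lemma ContinuousMap.toLInfty_apply (f : C(T, ℝ)) (t : T) : f.toLInfty t = f t := rfl

lemma LInfty.abs_sub_le_dist {T : Type*} (x y : LInfty T) (t : T) : |x t - y t| ≤ dist x y := by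
  rw [dist_eq_norm]
  exact lp.norm_apply_le_norm (by simp) (x - y) t

lemma ContinuousMap.isometry_toLInfty :
    Isometry (ContinuousMap.toLInfty : C(T, ℝ) → LInfty T) := by
  refine Isometry.of_dist_eq fun f g => le_antisymm ?_ ?_
  · rw [dist_eq_norm]
    refine lp.norm_le_of_forall_le dist_nonneg fun t => ?_
    exact (Real.dist_eq (f t) (g t)).symm.le.trans (ContinuousMap.dist_apply_le_dist t)
  · rw [ContinuousMap.dist_le dist_nonneg]
    intro t
    rw [Real.dist_eq]
    exact LInfty.abs_sub_le_dist f.toLInfty g.toLInfty t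

instance ContinuousMap.borelMeasurableSpace : MeasurableSpace C(T, ℝ) := borel _

instance ContinuousMap.instBorelSpace : BorelSpace C(T, ℝ) := ⟨rfl⟩

lemma measurable_of_closedBall {α Z : Type*} [MeasurableSpace α] [PseudoMetricSpace Z]
    [SecondCountableTopology Z] [MeasurableSpace Z] [BorelSpace Z] {f : α → Z}
    (h : ∀ z : Z, ∀ r > 0, MeasurableSet (f ⁻¹' closedBall z r)) : Measurable f := by
  refine measurable_of_isOpen fun U hU => ?_
  have hr : ∀ z : U, ∃ r > 0, closedBall (z : Z) r ⊆ U := fun z =>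
    Metric.nhds_basis_closedBall.mem_iff.1 (hU.mem_nhds z.2)
  choose r hr0 hr using hr
  obtain ⟨t, ht, hU'⟩ := TopologicalSpace.isOpen_iUnion_countable
    (fun z : U => ball (z : Z) (r z)) fun _ => isOpen_ball
  have : f ⁻¹' U = ⋃ z ∈ t, f ⁻¹' closedBall (z : Z) (r z) := by
    ext a
    simp only [mem_preimage, mem_iUnion]
    constructor
    · intro ha
      have h1 : f a ∈ ⋃ z : U, ball (z : Z) (r z) :=
        mem_iUnion.2 ⟨⟨f a, ha⟩, mem_ball_self (hr0 _)⟩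
      rw [← hU'] at h1
      obtain ⟨z, hz, hz'⟩ := mem_iUnion₂.1 h1
      exact ⟨z, hz, ball_subset_closedBall hz'⟩
    · rintro ⟨z, _, hz⟩
      exact hr z hz
  rw [this]
  exact MeasurableSet.biUnion ht fun z _ => h _ _ (hr0 z)

/-- By continuity, membership in a closed ball is decided on a countable dense set of points.
Evaluations are measurable only almost everywhere, so the argument runs in the σ-algebra of
null-measurable sets. -/
lemma ContinuousMap.aemeasurable_of_eval {T : Type*} [MetricSpace T] [CompactSpace T]
    {Ω' : Type*} [MeasurableSpace Ω'] {P' : Measure Ω'}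
    {Y : Ω' → C(T, ℝ)} (h : ∀ t, AEMeasurable (fun ω => Y ω t) P') : AEMeasurable Y P' := by
  have key : NullMeasurable Y P' := by
    refine measurable_of_closedBall (α := NullMeasurableSpace Ω' P') fun z r hr => ?_
    obtain ⟨s, hs, hsd⟩ := TopologicalSpace.exists_countable_dense T
    have : Y ⁻¹' closedBall z r = ⋂ t ∈ s, {ω | dist (Y ω t) (z t) ≤ r} := by
      ext ω
      simp only [mem_preimage, mem_closedBall, mem_iInter, mem_ofPred_eq]
      rw [ContinuousMap.dist_le hr.le]
      refine ⟨fun h t _ => h t, fun h t => ?_⟩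
      have hc : IsClosed {t | dist (Y ω t) (z t) ≤ r} :=
        isClosed_le ((Y ω).continuous.dist z.continuous) continuous_const
      exact closure_minimal h hc (hsd t)
    have hm : NullMeasurableSet (Y ⁻¹' closedBall z r) P' := by
      rw [this]
      exact NullMeasurableSet.biInter hs fun t _ =>
        ((h t).dist aemeasurable_const).nullMeasurable measurableSet_Iic
    exact hm
  exact key.aemeasurable

/-- Finitely many balls around a dense sequence of C(T, ℝ) capture the limit up to small
probability. The set of points at distance at least ε/2 from all their centres is closed in ℓ^∞, so
the portmanteau inequality passes this on to `X n`. -/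
lemma WeaklyConverges.exists_finset_net {T : Type*} [MetricSpace T] [CompactSpace T]
    {Ω Ω' : Type*} [MeasurableSpace Ω] [MeasurableSpace Ω'] {P : Measure Ω} {P' : Measure Ω'}
    [IsFiniteMeasure P'] {X : ℕ → Ω → LInfty T} {Y : Ω' → C(T, ℝ)}
    (h : WeaklyConverges P X P' fun ω => (Y ω).toLInfty) (hY : AEMeasurable Y P')
    {ε : ℝ} (hε : 0 < ε) {ε' : ℝ≥0∞} (hε' : 0 < ε') :
    ∃ F : Finset C(T, ℝ), ∀ᶠ n in atTop,
      P {ω | ¬ ∃ y ∈ F, ∀ t, |X n ω t - y t| < ε} ≤ ε' := by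
  classical
  let y := TopologicalSpace.denseSeq C(T, ℝ)
  have hlim : Tendsto (fun J : ℕ => P' {ω | ∀ j < J, ε / 2 ≤ dist (Y ω) (y j)}) atTop
      (𝓝 (P' (⋂ J : ℕ, {ω | ∀ j < J, ε / 2 ≤ dist (Y ω) (y j)}))) := by
    refine tendsto_measure_iInter_atTop (fun J => ?_) ?_ ⟨0, measure_ne_top _ _⟩
    · have : {ω | ∀ j < J, ε / 2 ≤ dist (Y ω) (y j)} =
          ⋂ j : ℕ, ⋂ _ : j < J, {ω | ε / 2 ≤ dist (Y ω) (y j)} := by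
        ext; simp
      rw [this]
      exact NullMeasurableSet.iInter fun j => NullMeasurableSet.iInter fun _ =>
        (hY.dist aemeasurable_const).nullMeasurable measurableSet_Ici
    · intro a b hab ω hω j hj
      exact hω j (hj.trans_le hab)
  have h0 : (⋂ J : ℕ, {ω | ∀ j < J, ε / 2 ≤ dist (Y ω) (y j)}) = ∅ := by
    refine eq_empty_of_forall_notMem fun ω hω => ?_
    obtain ⟨j, hj⟩ := (TopologicalSpace.denseRange_denseSeq C(T, ℝ)).exists_dist_lt (Y ω)
      (half_pos hε)
    exact absurd (mem_iInter.1 hω (j + 1) j (Nat.lt_succ_self j)) (not_le.2 hj)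
  rw [h0, measure_empty] at hlim
  obtain ⟨J, hJ⟩ := (hlim.eventually_lt_const hε').exists
  refine ⟨(Finset.range J).image y, ?_⟩
  let _ : MeasurableSpace (LInfty T) := borel _
  have _ : BorelSpace (LInfty T) := ⟨rfl⟩
  have hcl : IsClosed {x : LInfty T | ∀ j < J, ε / 2 ≤ dist x (y j).toLInfty} := by
    simp only [ofPred_forall]
    exact isClosed_iInter fun j => isClosed_iInter fun _ =>
      isClosed_le continuous_const (continuous_id.dist continuous_const)
  have hYm : AEMeasurable (fun ω => (Y ω).toLInfty) P' :=
    ContinuousMap.isometry_toLInfty.continuous.measurable.comp_aemeasurable hY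
  have hlt : P' ((fun ω => (Y ω).toLInfty) ⁻¹'
      {x : LInfty T | ∀ j < J, ε / 2 ≤ dist x (y j).toLInfty}) < ε' := by
    simpa only [preimage_ofPred_eq, ContinuousMap.isometry_toLInfty.dist_eq] using hJ
  filter_upwards [h.eventually_lt_of_isClosed hYm hcl hlt] with n hn
  refine (measure_mono fun ω hω j hj => ?_).trans hn.le
  by_contra! hlt
  refine hω ⟨y j, Finset.mem_image_of_mem _ (Finset.mem_range.2 hj), fun t => ?_⟩
  have := LInfty.abs_sub_le_dist (X n ω) (y j).toLInfty t
  rw [ContinuousMap.toLInfty_apply] at this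
  linarith

end Tightness

/-! ### The estimation error of the moment function -/

/-- `√n (mhat(θ) - m(θ))`. -/
noncomputable def rootError {Ω E : Type*} (m : E → ℝ) (mhat : ℕ → Ω → E → ℝ) (p : ℕ × Ω) (θ : E) :
    ℝ :=
  √(p.1 : ℝ) * (mhat p.1 p.2 θ - m θ)

section R1

variable {Ω Ω' E : Type*} [MeasurableSpace Ω] [MeasurableSpace Ω'] [MetricSpace E]
  {P : Measure Ω} {P' : Measure Ω'} [IsProbabilityMeasure P'] {D : Set E}
  {m : E → ℝ} {mhat : ℕ → Ω → E → ℝ} {G : E → Ω' → ℝ}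

-- Replaces the limit in ℓ^∞ by a version with values in C(D, ℝ), where separability is available.
omit [IsProbabilityMeasure P'] in
lemma ConditionR1.exists_limit [CompactSpace D] (h : ConditionR1 P P' D m mhat G) :
    ∃ (X : ℕ → Ω → LInfty D) (Y : Ω' → C(D, ℝ)),
      (∀ᶠ p in inProb P, ∀ θ : D, X p.1 p.2 θ = rootError m mhat p θ) ∧
      AEMeasurable Y P' ∧ (∀ᵐ ω' ∂P', ∀ θ : D, Y ω' θ = G θ ω') ∧
      WeaklyConverges P X P' (fun ω' => (Y ω').toLInfty) := by
  classical
  obtain ⟨X, Y, hX, hY, hXY⟩ := h.weak_limit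
  -- The value 0 is used only on the null set of discontinuous paths.
  let Z : Ω' → C(D, ℝ) := fun ω' =>
    if hc : ContinuousOn (fun θ => G θ ω') D then ⟨D.domRestrict fun θ => G θ ω', hc.domRestrict⟩ else 0
  have hZ : ∀ᵐ ω' ∂P', ∀ θ : D, Z ω' θ = G θ ω' := by
    filter_upwards [h.continuous_paths] with ω' hω' θ
    simp only [Z, dif_pos hω']
    rfl
  refine ⟨X, Z, eventually_inProb_of_ae (Eventually.of_forall hX), ?_, hZ, fun f => ?_⟩
  · refine ContinuousMap.aemeasurable_of_eval fun θ => (h.gaussian.aemeasurable θ).congr ?_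
    filter_upwards [hZ] with ω' hω'
    exact (hω' θ).symm
  · convert hXY f using 2
    refine lintegral_congr_ae ?_
    filter_upwards [hY, hZ] with ω' h1 h2
    have : (Z ω').toLInfty = Y ω' := by
      ext θ
      rw [ContinuousMap.toLInfty_apply, h1, h2]
    simp only [this]

lemma ConditionR1.exists_net [CompactSpace D] (h : ConditionR1 P P' D m mhat G)
    {ε : ℝ} (hε : 0 < ε) {ε' : ℝ≥0∞} (hε' : 0 < ε') :
    ∃ F : Finset C(D, ℝ), ∀ᶠ n in atTop,
      P {ω | ¬ ∃ y ∈ F, ∀ θ : D, |rootError m mhat (n, ω) θ - y θ| < ε} ≤ ε' := by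
  obtain ⟨X, Y, hX, hY, -, hXY⟩ := h.exists_limit
  obtain ⟨F, hF⟩ := hXY.exists_finset_net hY hε (ENNReal.half_pos hε'.ne')
  refine ⟨F, eventually_measure_le_of_imp hε'
    (A := fun p => ∃ y ∈ F, ∀ θ, |X p.1 p.2 θ - y θ| < ε)
    (C := fun p => ∃ y ∈ F, ∀ θ : D, |rootError m mhat p θ - y θ| < ε) hF ?_⟩
  filter_upwards [hX] with p hp
  simp only [hp]
  exact id

lemma ConditionR1.exists_bound [CompactSpace D] (h : ConditionR1 P P' D m mhat G)
    {ε' : ℝ≥0∞} (hε' : 0 < ε') :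
    ∃ M : ℝ, 0 < M ∧ ∀ᶠ n in atTop,
      P {ω | ¬ ∀ θ ∈ D, |rootError m mhat (n, ω) θ| ≤ M} ≤ ε' := by
  obtain ⟨F, hF⟩ := h.exists_net one_pos hε'
  refine ⟨∑ y ∈ F, ‖y‖ + 1, by positivity, ?_⟩
  filter_upwards [hF] with n hn
  refine (measure_mono fun ω hω => ?_).trans hn
  rintro ⟨y, hy, hyθ⟩
  refine hω fun θ hθ => ?_
  have h1 := hyθ ⟨θ, hθ⟩
  have h2 := y.norm_coe_le_norm ⟨θ, hθ⟩
  have h3 : ‖y‖ ≤ ∑ y ∈ F, ‖y‖ := 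
    Finset.single_le_sum (f := fun y : C(D, ℝ) => ‖y‖) (fun _ _ => norm_nonneg _) hy
  rw [Real.norm_eq_abs] at h2
  rw [abs_lt] at h1
  rw [abs_le] at h2 ⊢
  simp only at h1
  constructor <;> linarith

/-- The finitely many functions of the net are uniformly continuous on compact D and share a modulus
of continuity. -/
lemma ConditionR1.exists_equicontinuous [CompactSpace D] (h : ConditionR1 P P' D m mhat G)
    {ε : ℝ} (hε : 0 < ε) {ε' : ℝ≥0∞} (hε' : 0 < ε') :
    ∃ r : ℝ, 0 < r ∧ ∀ᶠ n in atTop,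
      P {ω | ¬ ∀ θ ∈ D, ∀ θ' ∈ D, dist θ θ' < r →
        |rootError m mhat (n, ω) θ - rootError m mhat (n, ω) θ'| ≤ ε} ≤ ε' := by
  obtain ⟨F, hF⟩ := h.exists_net (ε := ε / 3) (by positivity) hε'
  have hr : ∃ r : ℝ, 0 < r ∧ ∀ y ∈ F, ∀ θ θ' : D, dist θ θ' < r → dist (y θ) (y θ') < ε / 3 := by
    have h1 : ∀ y : C(D, ℝ), ∀ᶠ r : ℝ in 𝓝[>] 0, ∀ θ θ' : D, dist θ θ' < r →
        dist (y θ) (y θ') < ε / 3 := fun y => by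
      obtain ⟨r, hr, hry⟩ := Metric.uniformContinuous_iff.1
        (CompactSpace.uniformContinuous_of_continuous y.continuous) (ε / 3) (by positivity)
      filter_upwards [Ioo_mem_nhdsGT hr] with r' hr' θ θ' hθ
      exact hry (hθ.trans hr'.2)
    have h2 := (Finset.eventually_all F).2 fun y (_ : y ∈ F) => h1 y
    obtain ⟨r, hr, hr0⟩ := (h2.and self_mem_nhdsWithin).exists
    exact ⟨r, hr0, hr⟩
  obtain ⟨r, hr, hry⟩ := hr
  refine ⟨r, hr, ?_⟩
  filter_upwards [hF] with n hn
  refine (measure_mono fun ω hω => ?_).trans hn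
  rintro ⟨y, hy, hyθ⟩
  refine hω fun θ hθ θ' hθ' hd => ?_
  have h1 := hyθ ⟨θ, hθ⟩
  have h2 := hyθ ⟨θ', hθ'⟩
  have h3 := hry y hy ⟨θ, hθ⟩ ⟨θ', hθ'⟩ hd
  rw [Real.dist_eq] at h3
  rw [abs_lt] at h1 h2 h3
  rw [abs_le]
  simp only at h1 h2
  constructor <;> linarith

end R1

/-! ### The distance to a sublevel set -/

section Distance

variable {E : Type*} [NormedAddCommGroup E] [InnerProductSpace ℝ E] [CompleteSpace E]

lemma abs_sub_sub_inner_le_of_gradientWithin {f : E → ℝ} {D : Set E} {υ g : E} {r ε : ℝ}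
    (hf : DifferentiableOn ℝ f D) (hD : ball υ r ⊆ D)
    (hg : ∀ y ∈ ball υ r, ‖gradientWithin f D y - g‖ ≤ ε) {y : E} (hy : y ∈ ball υ r) :
    |f y - f υ - inner ℝ g (y - υ)| ≤ ε * ‖y - υ‖ := by
  have hr : 0 < r := pos_of_mem_ball hy
  have h := (convex_ball υ r).norm_image_sub_le_of_norm_hasFDerivWithin_le' (f := f)
    (f' := fun z => fderivWithin ℝ f D z) (φ := InnerProductSpace.toDual ℝ E g) (C := ε)
    (fun z hz => (hf z (hD hz)).hasFDerivWithinAt.mono hD) (fun z hz => ?_)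
    (mem_ball_self hr) hy
  · simpa using h
  · have h1 : fderivWithin ℝ f D z = InnerProductSpace.toDual ℝ E (gradientWithin f D z) := by
      simp [gradientWithin]
    rw [h1, ← map_sub, LinearIsometryEquiv.norm_map]
    exact hg z hz

/-- Walking from υ against g, f falls at rate at least ‖g‖ - ε and reaches 0 inside the ball, which
bounds the distance from above. No direction allows a rate beyond ‖g‖ + ε, which bounds it from
below. S has to agree with the sublevel set only on D: the image under η of the estimated set may
extend beyond the expansion of η(Θ). -/
lemma infDist_sublevel_bounds {f : E → ℝ} {D S : Set E} {υ g : E} {r ε : ℝ}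
    (hf : DifferentiableOn ℝ f D) (hD : ball υ r ⊆ D) (hr : 0 < r)
    (hS : ∀ y ∈ D, y ∈ S ↔ f y ≤ 0)
    (hg : ∀ y ∈ ball υ r, ‖gradientWithin f D y - g‖ ≤ ε) (hε : 0 ≤ ε) (hεg : ε < ‖g‖)
    (hsmall : f υ < r * (‖g‖ - ε)) :
    S.Nonempty ∧ infDist υ S * (‖g‖ - ε) ≤ max (f υ) 0 ∧
      max (f υ) 0 ≤ infDist υ S * (‖g‖ + ε) := by
  have hυ : υ ∈ D := hD (mem_ball_self hr)
  rcases le_or_gt (f υ) 0 with hneg | hpos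
  · have h1 : υ ∈ S := (hS υ hυ).2 hneg
    rw [infDist_zero_of_mem h1, max_eq_right hneg]
    exact ⟨⟨υ, h1⟩, by simp, by simp⟩
  rw [max_eq_left hpos.le]
  have hg0 : 0 < ‖g‖ := hε.trans_lt hεg
  have hge : 0 < ‖g‖ - ε := sub_pos.2 hεg
  -- The step length after which a fall at rate ‖g‖ - ε has used up f υ.
  set t := f υ / (‖g‖ - ε) with ht
  have ht0 : 0 ≤ t := by positivity
  have htr : t < r := by rwa [ht, div_lt_iff₀ hge]
  have htf : t * (‖g‖ - ε) = f υ := div_mul_cancel₀ _ hge.ne'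
  set y := υ - (t / ‖g‖) • g with hy
  have hyυ : y - υ = -((t / ‖g‖) • g) := by rw [hy]; abel
  have hnorm : ‖y - υ‖ = t := by
    rw [hyυ, norm_neg, norm_smul, Real.norm_of_nonneg (by positivity), div_mul_cancel₀ _ hg0.ne']
  have hyb : y ∈ ball υ r := by rwa [mem_ball_iff_norm, hnorm]
  have happ := abs_sub_sub_inner_le_of_gradientWithin hf hD hg hyb
  have hin : inner ℝ g (y - υ) = -(t * ‖g‖) := by
    rw [hyυ, inner_neg_right, inner_smul_right, real_inner_self_eq_norm_sq]
    field_simp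
  rw [hin, hnorm] at happ
  have hyS : y ∈ S := (hS y (hD hyb)).2 (by linarith [(abs_le.1 happ).2])
  refine ⟨⟨y, hyS⟩, ?_, ?_⟩
  · rw [← htf]
    refine mul_le_mul_of_nonneg_right ((infDist_le_dist_of_mem hyS).trans ?_) hge.le
    rw [dist_comm, dist_eq_norm, hnorm]
  · rw [← div_le_iff₀ (by positivity), le_infDist ⟨y, hyS⟩]
    intro z hz
    rw [div_le_iff₀ (by positivity)]
    rcases lt_or_ge (dist z υ) r with hzr | hzr
    · have h1 := abs_sub_sub_inner_le_of_gradientWithin hf hD hg hzr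
      have h2 := (hS z (hD hzr)).1 hz
      have h3 := abs_le.1 (abs_real_inner_le_norm g (z - υ))
      rw [dist_comm, dist_eq_norm]
      nlinarith [(abs_le.1 h1).1]
    -- A point outside the ball is at distance at least r, and r (‖g‖ + ε) already exceeds f υ.
    · rw [dist_comm]
      nlinarith

/-- With slope at most C, f cannot fall from κ to 0 in less than κ / C. Nonemptiness of S matters
because `infDist` to the empty set is 0. -/
lemma le_infDist_sublevel {f : E → ℝ} {D S : Set E} {υ : E} {r C κ : ℝ}
    (hf : DifferentiableOn ℝ f D) (hD : ball υ r ⊆ D)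
    (hS : ∀ y ∈ D, y ∈ S ↔ f y ≤ 0) (hC : 0 < C)
    (hg : ∀ y ∈ ball υ r, ‖gradientWithin f D y‖ ≤ C) (hS0 : S.Nonempty) (hκ : κ ≤ f υ) :
    min r (κ / C) ≤ infDist υ S := by
  rw [le_infDist hS0]
  intro z hz
  rw [min_le_iff, dist_comm]
  rcases lt_or_ge (dist z υ) r with hzr | hzr
  · right
    have h1 := abs_sub_sub_inner_le_of_gradientWithin (g := 0) hf hD (by simpa using hg) hzr
    have h2 := (hS z (hD hzr)).1 hz
    rw [div_le_iff₀ hC, dist_eq_norm]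
    simp only [inner_zero_left, sub_zero] at h1
    linarith [(abs_le.1 h1).1]
  · exact Or.inl hzr

end Distance

/-! ### Statistics that are asymptotically multiples of the positive part of the moment -/

/-- `√n [mhat(θ)]₊ / b(θ)`. -/
noncomputable def positiveScore {Ω E : Type*} (mhat : ℕ → Ω → E → ℝ) (b : E → ℝ) (p : ℕ × Ω)
    (θ : E) : ℝ :=
  √(p.1 : ℝ) * max (mhat p.1 p.2 θ) 0 / b θ

/-- The square root of the statistic equals `√n [mhat(θ)]₊ / b(θ)` up to a factor `1 + o_p(1)`,
uniformly over the points of `Θ` with small `mhat(θ)`. -/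
def RatioApprox {Ω E : Type*} [MeasurableSpace Ω] (P : Measure Ω) (Θ : Set E)
    (mhat stat : ℕ → Ω → E → ℝ) (b : E → ℝ) : Prop :=
  ∀ ε : ℝ, 0 < ε → ∃ κ : ℝ, 0 < κ ∧ ∀ᶠ p in inProb P, ∀ θ ∈ Θ, mhat p.1 p.2 θ ≤ κ →
    |√(stat p.1 p.2 θ) - positiveScore mhat b p θ| ≤ ε * positiveScore mhat b p θ

/-- The statistic diverges in probability, uniformly over the points of `Θ` with `mhat(θ)` bounded
away from zero. -/
def DivergesAbove {Ω E : Type*} [MeasurableSpace Ω] (P : Measure Ω) (Θ : Set E)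
    (mhat stat : ℕ → Ω → E → ℝ) : Prop :=
  ∀ κ : ℝ, 0 < κ → ∀ M : ℝ, ∀ᶠ p in inProb P, ∀ θ ∈ Θ, κ < mhat p.1 p.2 θ → M < stat p.1 p.2 θ

/-- Distance and weight each contribute a relative error e. Together they give the factors (1 ∓
e)⁻², which lie within 1 ± 8e for e ≤ 1/8. -/
lemma abs_mul_div_sub_le {s f d g w v e ε : ℝ} (hs : 0 ≤ s) (hd : 0 ≤ d) (hg : 0 < g) (hw : 0 < w)
    (he : 0 < e) (he1 : e ≤ 1 / 8) (heε : 8 * e ≤ ε)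
    (h1 : d * (g * (1 - e)) ≤ f) (h2 : f ≤ d * (g * (1 + e)))
    (h3 : w * (1 - e) ≤ v) (h4 : v ≤ w * (1 + e)) :
    |s * d / v - s * f / (w * g)| ≤ ε * (s * f / (w * g)) := by
  have he' : 0 < 1 - e := by linarith
  have hf : 0 ≤ f := le_trans (by positivity) h1
  have hv : 0 < v := lt_of_lt_of_le (by positivity) h3
  have hx : 0 ≤ s * f / (w * g) := by positivity
  have hup : s * d / v ≤ (1 + 8 * e) * (s * f / (w * g)) := by
    have h5 : s * d / v ≤ s * (f / (g * (1 - e))) / (w * (1 - e)) := by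
      gcongr
      rwa [le_div_iff₀ (by positivity)]
    have h6 : s * (f / (g * (1 - e))) / (w * (1 - e)) =
        s * f / (w * g) * (1 / (1 - e) ^ 2) := by field_simp
    have h7 : 1 / (1 - e) ^ 2 ≤ 1 + 8 * e := by
      rw [div_le_iff₀ (by positivity)]
      nlinarith [mul_pos he he, mul_pos he (mul_pos he he)]
    calc _ ≤ _ := h5
      _ = _ := h6
      _ ≤ s * f / (w * g) * (1 + 8 * e) := by gcongr
      _ = _ := mul_comm _ _
  have hlo : (1 - 8 * e) * (s * f / (w * g)) ≤ s * d / v := by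
    have h5 : s * (f / (g * (1 + e))) / (w * (1 + e)) ≤ s * d / v := by
      gcongr
      rwa [div_le_iff₀ (by positivity)]
    have h6 : s * (f / (g * (1 + e))) / (w * (1 + e)) =
        s * f / (w * g) * (1 / (1 + e) ^ 2) := by field_simp
    have h7 : 1 - 8 * e ≤ 1 / (1 + e) ^ 2 := by
      rw [le_div_iff₀ (by positivity)]
      nlinarith [mul_pos he he, mul_pos he (mul_pos he he)]
    calc _ = s * f / (w * g) * (1 - 8 * e) := mul_comm _ _
      _ ≤ s * f / (w * g) * (1 / (1 + e) ^ 2) := by gcongr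
      _ = _ := h6.symm
      _ ≤ _ := h5
  have h8 : 8 * e * (s * f / (w * g)) ≤ ε * (s * f / (w * g)) := by gcongr
  rw [abs_le]
  constructor <;> nlinarith

/-- As `s` is bounded away from zero, a uniform additive error is also a relative one. -/
lemma ConditionR3.eventually_bounds {Ω E : Type*} [MeasurableSpace Ω] [TopologicalSpace E]
    {P : Measure Ω} {D : Set E} {s : E → ℝ} {shat : ℕ → Ω → E → ℝ} (h : ConditionR3 P D s shat)
    {e : ℝ} (he : 0 < e) :
    ∀ᶠ p in inProb P, ∀ θ ∈ D, s θ * (1 - e) ≤ shat p.1 p.2 θ ∧ shat p.1 p.2 θ ≤ s θ * (1 + e) := by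
  obtain ⟨c, hc, hcs⟩ := h.bound
  filter_upwards [h.consistent.eventually (mul_pos hc he)] with p hp θ hθ
  have h1 := hp θ hθ
  have h2 := mul_le_mul_of_nonneg_right (hcs θ hθ) he.le
  rw [Real.dist_eq, abs_lt] at h1
  constructor <;> linarith

lemma ConditionR3.pos {Ω E : Type*} [MeasurableSpace Ω] [TopologicalSpace E]
    {P : Measure Ω} {D : Set E} {s : E → ℝ} {shat : ℕ → Ω → E → ℝ} (h : ConditionR3 P D s shat)
    {θ : E} (hθ : θ ∈ D) : 0 < s θ := by
  obtain ⟨c, hc, hcs⟩ := h.bound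
  exact hc.trans_le (hcs θ hθ)

lemma exists_ratio_tolerance {ε : ℝ} (hε : 0 < ε) : ∃ e : ℝ, 0 < e ∧ e ≤ 1 / 8 ∧ 8 * e ≤ ε :=
  ⟨min ε 1 / 8, by positivity, by linarith [min_le_right ε 1], by linarith [min_le_left ε 1]⟩

lemma lrStat_ratioApprox {Ω E : Type*} [MeasurableSpace Ω] [TopologicalSpace E]
    {P : Measure Ω} {Θ : Set E} {s : E → ℝ} {mhat shat : ℕ → Ω → E → ℝ}
    (h : ConditionR3 P Θ s shat) : RatioApprox P Θ mhat (lrStat mhat shat) s := by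
  intro ε hε
  obtain ⟨e, he, he1, heε⟩ := exists_ratio_tolerance hε
  refine ⟨1, one_pos, ?_⟩
  filter_upwards [h.eventually_bounds he] with p hp θ hθ _
  obtain ⟨h3, h4⟩ := hp θ hθ
  have hs := h.pos hθ
  have hv : 0 < shat p.1 p.2 θ := lt_of_lt_of_le (mul_pos hs (by linarith)) h3
  have hmax : max (√(p.1 : ℝ) * mhat p.1 p.2 θ / shat p.1 p.2 θ) 0 =
      √(p.1 : ℝ) * max (mhat p.1 p.2 θ) 0 / shat p.1 p.2 θ := by
    rw [mul_max_of_nonneg _ _ (Real.sqrt_nonneg _), mul_zero, ← max_div_div_right hv.le, zero_div]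
  have h0 : 0 ≤ max (mhat p.1 p.2 θ) 0 := le_max_right _ _
  -- The LR statistic is the case where the positive part of the moment itself plays the distance
  -- and the gradient norm is 1.
  have key := abs_mul_div_sub_le (s := √(p.1 : ℝ)) (f := max (mhat p.1 p.2 θ) 0)
    (d := max (mhat p.1 p.2 θ) 0) (g := 1) (w := s θ) (Real.sqrt_nonneg _) h0 one_pos hs he he1 heε
    (by nlinarith) (by nlinarith) h3 h4
  rw [lrStat, Real.sqrt_sq (le_max_right _ _), hmax, positiveScore]
  simpa using key

section Wald

variable {Ω E : Type*} [MeasurableSpace Ω] [NormedAddCommGroup E] [InnerProductSpace ℝ E]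
  [CompleteSpace E] {P : Measure Ω} {Θ : Set E} {δ : ℝ} {m w : E → ℝ} {mhat what : ℕ → Ω → E → ℝ}
  {S : ℕ → Ω → Set E}

omit [InnerProductSpace ℝ E] [CompleteSpace E] in
lemma ball_subset_cthickening_of_mem {θ : E} (hθ : θ ∈ Θ) {r : ℝ} (hr : r ≤ δ) :
    ball θ r ⊆ cthickening δ Θ :=
  (ball_subset_ball hr).trans ((ball_subset_thickening hθ δ).trans (thickening_subset_cthickening δ Θ))

lemma ConditionR2.eventually_infDist (h : ConditionR2 P (cthickening δ Θ) m mhat) (hδ : 0 < δ)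
    (hS : ∀ n ω, ∀ y ∈ cthickening δ Θ, y ∈ S n ω ↔ mhat n ω y ≤ 0)
    {e : ℝ} (he : 0 < e) (he1 : e < 1) :
    ∃ κ : ℝ, 0 < κ ∧ ∀ᶠ p in inProb P, ∀ θ ∈ Θ, mhat p.1 p.2 θ ≤ κ → (S p.1 p.2).Nonempty ∧
      infDist θ (S p.1 p.2) * (‖gradientWithin m (cthickening δ Θ) θ‖ * (1 - e)) ≤
        max (mhat p.1 p.2 θ) 0 ∧
      max (mhat p.1 p.2 θ) 0 ≤
        infDist θ (S p.1 p.2) * (‖gradientWithin m (cthickening δ Θ) θ‖ * (1 + e)) := by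
  obtain ⟨c, hc, hcm⟩ := h.gradient_bound
  obtain ⟨L, hL⟩ := h.lipschitz
  set D := cthickening δ Θ with hD
  -- On a ball of radius r the gradient of m varies by at most e c / 2. The estimation error of the
  -- gradient takes the other e c / 2, and e c ≤ e ‖g‖.
  set r := min δ (e * c / (2 * (L + 1))) with hr
  have hr0 : 0 < r := by positivity
  have hLr : L * r ≤ e * c / 2 := by
    have h1 : r * (2 * (L + 1)) ≤ e * c := by
      rw [← le_div_iff₀ (by positivity)]
      exact min_le_right _ _
    linarith
  refine ⟨r * (c * (1 - e)) / 2, by have := sub_pos.2 he1; positivity, ?_⟩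
  filter_upwards [h.consistent.eventually (ε := e * c / 2) (by positivity),
    eventually_inProb_of_ae (C := fun p => DifferentiableOn ℝ (mhat p.1 p.2) D)
      (Eventually.of_forall h.differentiable_hat)] with p hp hdiff θ hθ hκ
  have hθD : θ ∈ D := self_subset_cthickening Θ hθ
  have hball : ball θ r ⊆ D := ball_subset_cthickening_of_mem hθ (min_le_left _ _)
  set g := gradientWithin m D θ with hg
  have hcg : c ≤ ‖g‖ := hcm θ hθD
  have hclose : ∀ y ∈ ball θ r, ‖gradientWithin (mhat p.1 p.2) D y - g‖ ≤ e * ‖g‖ := by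
    intro y hy
    have h1 := hp y (hball hy)
    have h2 := hL.dist_le_mul y (hball hy) θ hθD
    have h3 : (L : ℝ) * dist y θ ≤ L * r := by gcongr; exact (mem_ball.1 hy).le
    have h4 : e * c ≤ e * ‖g‖ := by gcongr
    rw [← dist_eq_norm]
    linarith [dist_triangle (gradientWithin (mhat p.1 p.2) D y) (gradientWithin m D y) g]
  have hpos : 0 < r * (c * (1 - e)) := by have := sub_pos.2 he1; positivity
  have := infDist_sublevel_bounds hdiff hball hr0 (hS p.1 p.2) hclose (by positivity)
    (by nlinarith) (lt_of_le_of_lt hκ ?_)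
  · convert this using 4 <;> ring
  · have h1 : r * (c * (1 - e)) ≤ r * (‖g‖ * (1 - e)) := by
      have := sub_pos.2 he1
      gcongr
    linarith

lemma waldStat_ratioApprox (h2 : ConditionR2 P (cthickening δ Θ) m mhat)
    (h3 : ConditionR3 P (cthickening δ Θ) w what) (hδ : 0 < δ)
    (hS : ∀ n ω, ∀ y ∈ cthickening δ Θ, y ∈ S n ω ↔ mhat n ω y ≤ 0) :
    RatioApprox P Θ mhat (fun n ω θ => (√(n : ℝ) * infDist θ (S n ω) / what n ω θ) ^ 2)
      (fun θ => w θ * ‖gradientWithin m (cthickening δ Θ) θ‖) := by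
  intro ε hε
  obtain ⟨e, he, he1, heε⟩ := exists_ratio_tolerance hε
  obtain ⟨κ, hκ, hev⟩ := h2.eventually_infDist hδ hS he (by linarith)
  obtain ⟨c, hc, hcm⟩ := h2.gradient_bound
  refine ⟨κ, hκ, ?_⟩
  filter_upwards [hev, h3.eventually_bounds he] with p hp hw θ hθ hθκ
  have hθD : θ ∈ cthickening δ Θ := self_subset_cthickening Θ hθ
  obtain ⟨-, h4, h5⟩ := hp θ hθ hθκ
  obtain ⟨h6, h7⟩ := hw θ hθD
  have hwp := h3.pos hθD
  have hv : 0 < what p.1 p.2 θ := lt_of_lt_of_le (mul_pos hwp (by linarith)) h6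
  have hd : 0 ≤ infDist θ (S p.1 p.2) := infDist_nonneg
  rw [Real.sqrt_sq (by positivity), positiveScore]
  exact abs_mul_div_sub_le (Real.sqrt_nonneg _) hd (hc.trans_le (hcm θ hθD)) hwp he he1 heε
    h4 h5 h6 h7

/-- A large moment forces a distance bounded below, which √n sends to infinity. The point θ₀ ensures
that the estimated set is nonempty; otherwise `infDist`, and with it the statistic, would be 0. -/
lemma waldStat_divergesAbove [ProperSpace E] (hΘ : IsCompact Θ)
    (h2 : ConditionR2 P (cthickening δ Θ) m mhat)
    (h3 : ConditionR3 P (cthickening δ Θ) w what) (hδ : 0 < δ)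
    (hS : ∀ n ω, ∀ y ∈ cthickening δ Θ, y ∈ S n ω ↔ mhat n ω y ≤ 0) {θ₀ : E} (hθ₀ : θ₀ ∈ Θ)
    (hm : Tendsto (fun p : ℕ × Ω => mhat p.1 p.2 θ₀) (inProb P) (𝓝 0)) :
    DivergesAbove P Θ mhat (fun n ω θ => (√(n : ℝ) * infDist θ (S n ω) / what n ω θ) ^ 2) := by
  intro κ hκ M
  obtain ⟨κ', hκ', hev⟩ := h2.eventually_infDist hδ hS (e := 1 / 2) (by norm_num) (by norm_num)
  have hD : IsCompact (cthickening δ Θ) := hΘ.cthickening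
  obtain ⟨C, hC⟩ := hD.exists_bound_of_continuousOn h2.continuous_gradient
  obtain ⟨W, hW⟩ := hD.exists_bound_of_continuousOn h3.continuous
  have hθ₀D : θ₀ ∈ cthickening δ Θ := self_subset_cthickening Θ hθ₀
  have hC0 : 0 ≤ C := (norm_nonneg _).trans (hC θ₀ hθ₀D)
  have hW0 : 0 < W := lt_of_lt_of_le (h3.pos hθ₀D) ((le_abs_self _).trans (hW θ₀ hθ₀D))
  -- C + 1 bounds the gradient of `mhat` once it is within 1 of that of m.
  set d := min δ (κ / (C + 1)) with hd
  have hd0 : 0 < d := by positivity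
  have hlim : Tendsto (fun p : ℕ × Ω => (√(p.1 : ℝ) * d / (W * 2)) ^ 2) (inProb P) atTop := by
    have h1 : Tendsto (fun n : ℕ => (√(n : ℝ) * d / (W * 2)) ^ 2) atTop atTop := by
      refine (tendsto_pow_atTop two_ne_zero).comp (Tendsto.atTop_div_const (by positivity) ?_)
      exact (Real.tendsto_sqrt_atTop.comp tendsto_natCast_atTop_atTop).atTop_mul_const hd0
    exact h1.comp tendsto_fst_inProb
  filter_upwards [hev, hm.eventually_le_const hκ', h2.consistent.eventually one_pos,
    eventually_inProb_of_ae (C := fun p => DifferentiableOn ℝ (mhat p.1 p.2) (cthickening δ Θ))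
      (Eventually.of_forall h2.differentiable_hat), h3.eventually_bounds (e := 1 / 2) (by norm_num),
    hlim.eventually_gt_atTop M] with p hp hθ₀p hgrad hdiff hw hM θ hθ hθκ
  have hθD : θ ∈ cthickening δ Θ := self_subset_cthickening Θ hθ
  have hball : ball θ δ ⊆ cthickening δ Θ := ball_subset_cthickening_of_mem hθ le_rfl
  have hle : d ≤ infDist θ (S p.1 p.2) := by
    refine le_infDist_sublevel hdiff hball (hS p.1 p.2) (by positivity) (fun y hy => ?_)
      (hp θ₀ hθ₀ hθ₀p).1 hθκ.le
    have h4 := hgrad y (hball hy)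
    have h5 := hC y (hball hy)
    rw [dist_eq_norm] at h4
    linarith [norm_le_norm_add_norm_sub' (gradientWithin (mhat p.1 p.2) (cthickening δ Θ) y)
      (gradientWithin m (cthickening δ Θ) y)]
  obtain ⟨h6, h7⟩ := hw θ hθD
  have hwp := h3.pos hθD
  have hwW : w θ ≤ W := (le_abs_self _).trans (hW θ hθD)
  have hv : 0 < what p.1 p.2 θ := lt_of_lt_of_le (by linarith) h6
  have hi : 0 ≤ infDist θ (S p.1 p.2) := infDist_nonneg
  refine hM.trans_le ?_
  gcongr
  linarith

end Wald

/-! ### Suprema of the statistics over subsets of the identified set -/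

/-- `sup_{θ ∈ B} [x(θ)]₊ / b(θ)` for `x ∈ ℓ^∞(D)`. -/
noncomputable def supScore {E : Type*} {D : Set E} (B : Set E) (b : E → ℝ) (x : LInfty D) : ℝ :=
  sSup ((fun θ : D => max (x θ) 0 / b θ) '' {θ | (θ : E) ∈ B})

section SupScore

variable {E : Type*} {D B : Set E} {b : E → ℝ} {c : ℝ}

lemma le_supScore (hc : 0 < c) (hb : ∀ θ ∈ B, c ≤ b θ) (x : LInfty D) {θ : D}
    (hθ : (θ : E) ∈ B) : max (x θ) 0 / b θ ≤ supScore B b x := by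
  refine le_csSup ⟨‖x‖ / c, ?_⟩ (mem_image_of_mem _ hθ)
  rintro _ ⟨θ, hθ, rfl⟩
  have h1 : max (x θ) 0 ≤ ‖x‖ :=
    max_le ((le_abs_self _).trans (lp.norm_apply_le_norm (by simp) x θ)) (norm_nonneg _)
  exact div_le_div₀ (norm_nonneg _) h1 hc (hb θ hθ)

lemma supScore_le (hB : B.Nonempty) (hBD : B ⊆ D) {x : LInfty D} {M : ℝ}
    (h : ∀ θ : D, (θ : E) ∈ B → max (x θ) 0 / b θ ≤ M) : supScore B b x ≤ M := by
  obtain ⟨θ, hθ⟩ := hB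
  refine csSup_le ⟨_, mem_image_of_mem _ (show (⟨θ, hBD hθ⟩ : D) ∈ {θ : D | (θ : E) ∈ B} from hθ)⟩ ?_
  rintro _ ⟨θ, hθ, rfl⟩
  exact h θ hθ

lemma supScore_nonneg (hc : 0 < c) (hb : ∀ θ ∈ B, c ≤ b θ) (x : LInfty D) :
    0 ≤ supScore B b x := by
  refine Real.sSup_nonneg ?_
  rintro _ ⟨θ, hθ, rfl⟩
  exact div_nonneg (le_max_right _ _) (hc.le.trans (hb θ hθ))

lemma continuous_supScore (hB : B.Nonempty) (hBD : B ⊆ D) (hc : 0 < c) (hb : ∀ θ ∈ B, c ≤ b θ) :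
    Continuous (supScore (D := D) B b) := by
  refine (LipschitzWith.of_le_add_mul (Real.toNNReal c⁻¹) fun x y => ?_).continuous
  rw [Real.coe_toNNReal _ (inv_nonneg.2 hc.le)]
  refine supScore_le hB hBD fun θ hθ => ?_
  have h1 := le_supScore hc hb y hθ
  have hbθ := hb θ hθ
  have h2 : max (x θ) 0 ≤ max (y θ) 0 + dist x y := by
    have := (abs_le.1 (LInfty.abs_sub_le_dist x y θ)).2
    refine max_le ?_ (by positivity)
    linarith [le_max_left (y θ) 0]
  calc max (x θ) 0 / b θ ≤ (max (y θ) 0 + dist x y) / b θ := by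
        have := hc.trans_le hbθ
        gcongr
    _ = max (y θ) 0 / b θ + dist x y / b θ := add_div _ _ _
    _ ≤ supScore B b y + c⁻¹ * dist x y := by
        gcongr
        rw [div_eq_inv_mul]
        gcongr

lemma supScore_congr {b' : E → ℝ} (h : ∀ θ ∈ B, b θ = b' θ) (x : LInfty D) :
    supScore B b x = supScore B b' x := by
  unfold supScore
  congr 1
  refine image_congr fun θ hθ => ?_
  simp only [h θ hθ]

lemma supScore_singleton (θ : D) (b : E → ℝ) (x : LInfty D) :
    supScore {(θ : E)} b x = max (x θ) 0 / b θ := by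
  have : {θ' : D | (θ' : E) ∈ ({(θ : E)} : Set E)} = {θ} := by
    ext θ'
    simp [Subtype.ext_iff]
  rw [supScore, this, image_singleton, csSup_singleton]

end SupScore

lemma IsCompact.exists_pos_forall_le {E : Type*} [TopologicalSpace E] {Θ : Set E}
    (hΘ : IsCompact Θ) {b : E → ℝ} (hb : ContinuousOn b Θ) (hb0 : ∀ θ ∈ Θ, 0 < b θ) :
    ∃ c : ℝ, 0 < c ∧ ∀ θ ∈ Θ, c ≤ b θ := by
  rcases Θ.eq_empty_or_nonempty with rfl | hne
  · exact ⟨1, one_pos, by simp⟩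
  · obtain ⟨θ, hθ, hmin⟩ := hΘ.exists_isMinOn hne hb
    exact ⟨b θ, hb0 θ hθ, fun θ' hθ' => hmin hθ'⟩

lemma div_le_div_add_of_close {u u' b b' c e M : ℝ} (hc : 0 < c) (hb : c ≤ b) (hb' : c ≤ b')
    (hbb : |b - b'| ≤ e) (hu0 : 0 ≤ u') (hu : u ≤ u' + e) (huM : u' ≤ M) :
    u / b ≤ u' / b' + (e / c + M * e / c ^ 2) := by
  have he : 0 ≤ e := (abs_nonneg _).trans hbb
  have hb0 := hc.trans_le hb
  have hb0' := hc.trans_le hb'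
  have h1 : u / b ≤ u' / b + e / b := by
    rw [← add_div]
    gcongr
  have h2 : e / b ≤ e / c := by gcongr
  have h3 : u' / b = u' / b' + u' * (b' - b) / (b * b') := by
    field_simp
    ring
  have h4 : u' * (b' - b) / (b * b') ≤ M * e / c ^ 2 := by
    have hM : 0 ≤ M := hu0.trans huM
    have h5 : u' * (b' - b) ≤ M * e := by
      have : b' - b ≤ e := by linarith [(abs_le.1 hbb).1]
      calc u' * (b' - b) ≤ u' * e := by gcongr
        _ ≤ M * e := by gcongr
    have h6 : c ^ 2 ≤ b * b' := by nlinarith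
    exact div_le_div₀ (by positivity) h5 (by positivity) h6
  linarith

lemma tendsto_sqrt_natCast_mul_inProb {Ω : Type*} [MeasurableSpace Ω] {P : Measure Ω} {κ : ℝ}
    (hκ : 0 < κ) : Tendsto (fun p : ℕ × Ω => √(p.1 : ℝ) * κ) (inProb P) atTop := by
  have h1 : Tendsto (fun n : ℕ => √(n : ℝ) * κ) atTop atTop :=
    (Real.tendsto_sqrt_atTop.comp tendsto_natCast_atTop_atTop).atTop_mul_const hκ
  exact h1.comp tendsto_fst_inProb

lemma WeaklyConverges.of_sqrt {Ω Ω' : Type*} [MeasurableSpace Ω] [MeasurableSpace Ω']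
    {P : Measure Ω} {P' : Measure Ω'} {T : ℕ → Ω → ℝ} {V : Ω' → ℝ}
    (h : WeaklyConverges P (fun n ω => √(T n ω)) P' V) (hT : ∀ n ω, 0 ≤ T n ω) :
    WeaklyConverges P T P' (fun ω' => V ω' ^ 2) := by
  intro f
  have h2 := h (f.compContinuous ⟨fun x => x ^ 2, continuous_pow 2⟩)
  simpa [Real.sq_sqrt (hT _ _)] using h2

section Sup

variable {Ω Ω' E : Type*} [MeasurableSpace Ω] [MeasurableSpace Ω'] [MetricSpace E]
  {P : Measure Ω} {P' : Measure Ω'} [IsProbabilityMeasure P'] {D Θ A B : Set E}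
  {m b : E → ℝ} {mhat stat : ℕ → Ω → E → ℝ} {G : E → Ω' → ℝ} {X : ℕ → Ω → LInfty D}

/-- Points of A with m ≤ -κ₁ have score zero once √n κ₁ exceeds the bound M on the root error. The
other points are close to B, where the root error and b hardly change, and the drift √n m ≤ 0 only
lowers the score. Conversely B ⊆ A, and there is no drift on B. -/
lemma tendsto_sqrt_supStat_sub [CompactSpace D] (h : ConditionR1 P P' D m mhat G)
    (hX : ∀ᶠ p in inProb P, ∀ θ : D, X p.1 p.2 θ = rootError m mhat p θ)
    (hΘ : IsCompact Θ) (hΘD : Θ ⊆ D) (hb : ContinuousOn b Θ) (hb0 : ∀ θ ∈ Θ, 0 < b θ)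
    (hratio : RatioApprox P Θ mhat stat b)
    (hB : B.Nonempty) (hBm : ∀ θ ∈ B, m θ = 0) (hBA : B ⊆ A) (hAΘ : A ⊆ Θ)
    (hAm : ∀ θ ∈ A, m θ ≤ 0)
    (hAB : ∀ r : ℝ, 0 < r → ∃ κ : ℝ, 0 < κ ∧ ∀ θ ∈ A, -κ < m θ → ∃ θ' ∈ B, dist θ θ' < r) :
    Tendsto (fun p : ℕ × Ω => √(supStat A stat p.1 p.2) - supScore B b (X p.1 p.2))
      (inProb P) (𝓝 0) := by
  obtain ⟨c, hc, hcb⟩ := hΘ.exists_pos_forall_le hb hb0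
  have hcB : ∀ θ ∈ B, c ≤ b θ := fun θ hθ => hcb θ (hAΘ (hBA hθ))
  have hBD : B ⊆ D := (hBA.trans hAΘ).trans hΘD
  rw [Metric.tendsto_nhds]
  intro ε hε
  refine eventually_inProb_of_forall fun ε' hε' => ?_
  have hε'2 := ENNReal.half_pos hε'.ne'
  obtain ⟨M, hM, hbound⟩ := h.exists_bound hε'2
  -- Makes the cost of moving to B, e/c + M e/c², and the relative error e M/c add up to ε/2.
  set e := ε / 2 / (1 / c + M / c ^ 2 + M / c) with he
  have he0 : 0 < e := by positivity
  have heε : e / c + M * e / c ^ 2 + e * (M / c) = ε / 2 := by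
    have : e * (1 / c + M / c ^ 2 + M / c) = ε / 2 := div_mul_cancel₀ _ (by positivity)
    rw [← this]
    ring
  obtain ⟨r₁, hr₁, hequi⟩ := h.exists_equicontinuous he0 hε'2
  obtain ⟨r₂, hr₂, hbu⟩ := Metric.uniformContinuousOn_iff.1
    (hΘ.uniformContinuousOn_of_continuous hb) e he0
  obtain ⟨κ₁, hκ₁, hAB⟩ := hAB (min r₁ r₂) (lt_min hr₁ hr₂)
  obtain ⟨κ, hκ, hratio⟩ := hratio e he0
  refine ⟨fun p => (∀ θ ∈ D, |rootError m mhat p θ| ≤ M) ∧ ∀ θ ∈ D, ∀ θ' ∈ D, dist θ θ' < r₁ →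
    |rootError m mhat p θ - rootError m mhat p θ'| ≤ e, ?_, ?_⟩
  · filter_upwards [hbound, hequi] with n h1 h2
    calc _ ≤ _ := measure_mono fun ω hω => not_and_or.1 hω
      _ ≤ _ := measure_union_le _ _
      _ ≤ ε' / 2 + ε' / 2 := add_le_add h1 h2
      _ = ε' := ENNReal.add_halves ε'
  filter_upwards [hX, hratio, (tendsto_sqrt_natCast_mul_inProb hκ₁).eventually_gt_atTop M,
    (tendsto_sqrt_natCast_mul_inProb hκ).eventually_gt_atTop M] with p hX hratio hnκ₁ hnκ ⟨hZM, hZe⟩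
  set Φ := supScore B b (X p.1 p.2) with hΦ
  have hΦ0 : 0 ≤ Φ := supScore_nonneg hc hcB _
  have hsn : 0 < √(p.1 : ℝ) := by
    by_contra! hle
    nlinarith
  have hle_Φ : ∀ θ ∈ B, max (rootError m mhat p θ) 0 / b θ ≤ Φ := fun θ hθ => by
    have := le_supScore hc hcB (X p.1 p.2) (θ := ⟨θ, hBD hθ⟩) hθ
    rwa [hX] at this
  have hscore : ∀ θ, positiveScore mhat b p θ =
      max (rootError m mhat p θ + √(p.1 : ℝ) * m θ) 0 / b θ := fun θ => by
    rw [positiveScore, mul_max_of_nonneg _ _ hsn.le, mul_zero, rootError]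
    ring_nf
  have hle : ∀ θ ∈ A, rootError m mhat p θ + √(p.1 : ℝ) * m θ ≤ rootError m mhat p θ :=
    fun θ hθ => by nlinarith [hAm θ hθ]
  have happ : ∀ θ ∈ A, |√(stat p.1 p.2 θ) - positiveScore mhat b p θ| ≤ e * (M / c) := by
    intro θ hθ
    have hZ := hZM θ (hΘD (hAΘ hθ))
    have h1 : mhat p.1 p.2 θ ≤ κ := by
      have h2 : √(p.1 : ℝ) * mhat p.1 p.2 θ = rootError m mhat p θ + √(p.1 : ℝ) * m θ := by
        rw [rootError]; ring
      have h3 := hle θ hθ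
      refine le_of_mul_le_mul_left ?_ hsn
      linarith [(abs_le.1 hZ).2]
    refine (hratio θ (hAΘ hθ) h1).trans (mul_le_mul_of_nonneg_left ?_ he0.le)
    rw [hscore]
    exact div_le_div₀ hM.le (max_le ((hle θ hθ).trans ((le_abs_self _).trans hZ)) hM.le) hc
      (hcb θ (hAΘ hθ))
  have hup : ∀ θ ∈ A, stat p.1 p.2 θ ≤ (Φ + ε / 2) ^ 2 := by
    intro θ hθ
    have hθΘ := hAΘ hθ
    have hbθ := hcb θ hθΘ
    have hR : positiveScore mhat b p θ ≤ Φ + (e / c + M * e / c ^ 2) := by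
      rw [hscore]
      rcases le_or_gt (m θ) (-κ₁) with hm | hm
      · have h1 : rootError m mhat p θ + √(p.1 : ℝ) * m θ ≤ 0 := by
          nlinarith [(abs_le.1 (hZM θ (hΘD hθΘ))).2]
        rw [max_eq_right h1, zero_div]
        positivity
      · obtain ⟨θ', hθ', hd⟩ := hAB θ hθ hm
        have hθ'Θ := hAΘ (hBA hθ')
        have h1 := hZe θ (hΘD hθΘ) θ' (hΘD hθ'Θ) (hd.trans_le (min_le_left _ _))
        have h2 := hbu θ hθΘ θ' hθ'Θ (hd.trans_le (min_le_right _ _))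
        have h3 := hZM θ' (hΘD hθ'Θ)
        refine (div_le_div_add_of_close hc hbθ (hcb θ' hθ'Θ) h2.le
          (le_max_right (rootError m mhat p θ') 0) ?_ (max_le ((le_abs_self _).trans h3) hM.le)).trans
          (by gcongr; exact hle_Φ θ' hθ')
        refine max_le ?_ (by positivity)
        linarith [hle θ hθ, le_max_left (rootError m mhat p θ') 0, (abs_le.1 h1).2]
    rw [← Real.sqrt_le_left (by positivity)]
    linarith [(abs_le.1 (happ θ hθ)).2]
  have hAne : (stat p.1 p.2 '' A).Nonempty := (hB.mono hBA).image _
  have hT1 : √(supStat A stat p.1 p.2) ≤ Φ + ε / 2 := by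
    rw [Real.sqrt_le_left (by positivity)]
    refine csSup_le hAne ?_
    rintro _ ⟨θ, hθ, rfl⟩
    exact hup θ hθ
  have hT2 : Φ ≤ √(supStat A stat p.1 p.2) + ε / 2 := by
    refine supScore_le hB hBD fun θ hθ => ?_
    -- The bound `hup` is needed here too: `sSup` of an unbounded set would be 0.
    have h1 : √(stat p.1 p.2 θ) ≤ √(supStat A stat p.1 p.2) := by
      refine Real.sqrt_le_sqrt (le_csSup ⟨(Φ + ε / 2) ^ 2, ?_⟩ (mem_image_of_mem _ (hBA hθ)))
      rintro _ ⟨θ, hθ, rfl⟩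
      exact hup θ hθ
    have h2 := happ θ (hBA hθ)
    rw [hscore, hBm θ hθ, mul_zero, add_zero] at h2
    have h3 : 0 < e / c + M * e / c ^ 2 := by positivity
    rw [hX]
    linarith [(abs_le.1 h2).1]
  rw [Real.dist_eq, sub_zero, abs_lt]
  constructor <;> linarith

/-- The limit involves B but not A, so suprema over Θ₀ and over ∂Θ₀ share one limit law. -/
lemma weaklyConverges_supStat [IsProbabilityMeasure P] [CompactSpace D]
    (h : ConditionR1 P P' D m mhat G) {Y : Ω' → C(D, ℝ)}
    (hX : ∀ᶠ p in inProb P, ∀ θ : D, X p.1 p.2 θ = rootError m mhat p θ) (hY : AEMeasurable Y P')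
    (hXY : WeaklyConverges P X P' fun ω' => (Y ω').toLInfty)
    (hΘ : IsCompact Θ) (hΘD : Θ ⊆ D) (hb : ContinuousOn b Θ) (hb0 : ∀ θ ∈ Θ, 0 < b θ)
    (hratio : RatioApprox P Θ mhat stat b) (hstat : ∀ n ω θ, 0 ≤ stat n ω θ)
    (hB : B.Nonempty) (hBm : ∀ θ ∈ B, m θ = 0) (hBA : B ⊆ A) (hAΘ : A ⊆ Θ)
    (hAm : ∀ θ ∈ A, m θ ≤ 0)
    (hAB : ∀ r : ℝ, 0 < r → ∃ κ : ℝ, 0 < κ ∧ ∀ θ ∈ A, -κ < m θ → ∃ θ' ∈ B, dist θ θ' < r) :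
    AEMeasurable (fun ω' => supScore B b (Y ω').toLInfty ^ 2) P' ∧
    WeaklyConverges P (supStat A stat) P' (fun ω' => supScore B b (Y ω').toLInfty ^ 2) := by
  obtain ⟨c, hc, hcb⟩ := hΘ.exists_pos_forall_le hb hb0
  have hcB : ∀ θ ∈ B, c ≤ b θ := fun θ hθ => hcb θ (hAΘ (hBA hθ))
  have hBD : B ⊆ D := (hBA.trans hAΘ).trans hΘD
  have hcont := continuous_supScore hB hBD hc hcB
  have hm : AEMeasurable (fun ω' => supScore B b (Y ω').toLInfty) P' :=
    (hcont.comp ContinuousMap.isometry_toLInfty.continuous).measurable.comp_aemeasurable hY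
  refine ⟨hm.pow_const 2, ?_⟩
  have h1 : WeaklyConverges P (fun n ω => √(supStat A stat n ω)) P'
      (fun ω' => supScore B b (Y ω').toLInfty) :=
    (hXY.comp hcont).of_tendsto_sub hm
      (tendsto_sqrt_supStat_sub h hX hΘ hΘD hb hb0 hratio hB hBm hBA hAΘ hAm hAB)
  refine h1.of_sqrt fun n ω => Real.sSup_nonneg ?_
  rintro _ ⟨θ, _, rfl⟩
  exact hstat n ω θ

end Sup

/-! ### Gaussian limits and quantiles -/

section Gaussian

lemma gaussianReal_Iic_zero_le : gaussianReal 0 1 (Iic 0) ≤ 1 / 2 := by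
  have := nullSingletonClass_gaussianReal (μ := 0) (v := 1) one_ne_zero
  have h1 : gaussianReal 0 1 (Iic 0) = gaussianReal 0 1 (Ioi 0) := by
    have h2 : (gaussianReal 0 1).map (fun x => -x) = gaussianReal 0 1 := by
      simpa using gaussianReal_map_neg (μ := 0) (v := 1)
    conv_lhs => rw [← h2]
    rw [Measure.map_apply measurable_neg measurableSet_Iic, measure_congr Ioi_ae_eq_Ici]
    congr 1
    ext x
    simp
  have h3 : gaussianReal 0 1 (Iic 0) + gaussianReal 0 1 (Iic 0) = 1 := by
    conv_lhs => rw [h1]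
    nth_rw 1 [← h1]
    rw [← compl_Iic]
    exact prob_add_prob_compl measurableSet_Iic
  rw [ENNReal.le_div_iff_mul_le (by simp) (by simp), mul_two, h3]

lemma gaussianReal_pos_of_isOpen {U : Set ℝ} (hU : IsOpen U) (hne : U.Nonempty) :
    0 < gaussianReal 0 1 U := by
  refine pos_iff_ne_zero.2 fun h => ?_
  exact (hU.measure_pos volume hne).ne' (gaussianReal_absolutelyContinuous' 0 one_ne_zero h)

variable {Ω Ω' E : Type*} [MeasurableSpace Ω] [MeasurableSpace Ω'] [TopologicalSpace E]
  {P : Measure Ω} {P' : Measure Ω'} [IsProbabilityMeasure P'] {D : Set E}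
  {m : E → ℝ} {mhat : ℕ → Ω → E → ℝ} {G : E → Ω' → ℝ}

omit [IsProbabilityMeasure P'] in
lemma ConditionR1.sd_pos (h : ConditionR1 P P' D m mhat G) {θ : E} (hθ : θ ∈ D) :
    0 < √(∫ ω', (G θ ω') ^ 2 ∂P') := by
  obtain ⟨c, hc, hcG⟩ := h.nondegenerate
  exact Real.sqrt_pos.2 (hc.trans_le (hcG θ hθ))

omit [IsProbabilityMeasure P'] in
lemma ConditionR1.aemeasurable_limit (h : ConditionR1 P P' D m mhat G) {θ : E} (hθ : θ ∈ D) :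
    AEMeasurable (G θ) P' :=
  h.gaussian.aemeasurable ⟨θ, hθ⟩

omit [IsProbabilityMeasure P'] in
lemma ConditionR1.map_standardized (h : ConditionR1 P P' D m mhat G) {θ : E} (hθ : θ ∈ D) :
    P'.map (fun ω' => G θ ω' / √(∫ ω', (G θ ω') ^ 2 ∂P')) = gaussianReal 0 1 := by
  have hm := h.aemeasurable_limit hθ
  have h1 := (h.gaussian.hasGaussianLaw_eval ⟨θ, hθ⟩).map_eq_gaussianReal
  have h2 : P'.map (G θ) = gaussianReal 0 (∫ ω', (G θ ω') ^ 2 ∂P').toNNReal := by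
    rw [← variance_of_integral_eq_zero hm (h.centered θ hθ), ← h.centered θ hθ]
    exact h1
  have h3 : P'.map (fun ω' => G θ ω' / √(∫ ω', (G θ ω') ^ 2 ∂P')) =
      (P'.map (G θ)).map (· / √(∫ ω', (G θ ω') ^ 2 ∂P')) :=
    
    (AEMeasurable.map_map_of_aemeasurable (g := fun x => x / √(∫ ω', (G θ ω') ^ 2 ∂P'))
      (by fun_prop) hm).symm
  have hpos := Real.sqrt_pos.1 (h.sd_pos hθ)
  rw [h3, h2, gaussianReal_map_div_const, zero_div]
  congr 1
  ext
  simp only [NNReal.coe_div, Real.coe_toNNReal _ hpos.le, NNReal.coe_mk, Real.sq_sqrt hpos.le,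
    div_self hpos.ne', NNReal.coe_one]

omit [IsProbabilityMeasure P'] in
lemma ConditionR1.measure_standardized (h : ConditionR1 P P' D m mhat G) {θ : E} (hθ : θ ∈ D)
    {S : Set ℝ} (hS : MeasurableSet S) :
    P' {ω' | G θ ω' / √(∫ ω', (G θ ω') ^ 2 ∂P') ∈ S} = gaussianReal 0 1 S := by
  rw [← h.map_standardized hθ, Measure.map_apply_of_aemeasurable
    ((h.aemeasurable_limit hθ).div_const _) hS]
  rfl

omit [IsProbabilityMeasure P'] in
lemma ConditionR1.measure_nonpos_le (h : ConditionR1 P P' D m mhat G) {θ : E} (hθ : θ ∈ D) :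
    P' {ω' | G θ ω' ≤ 0} ≤ 1 / 2 := by
  refine le_trans (le_of_eq ?_) gaussianReal_Iic_zero_le
  rw [← h.measure_standardized hθ measurableSet_Iic]
  congr 1
  ext ω'
  simp only [mem_ofPred_eq, mem_Iic]
  rw [div_le_iff₀ (h.sd_pos hθ), zero_mul]

omit [IsProbabilityMeasure P'] in
lemma ConditionR1.measure_eq_zero (h : ConditionR1 P P' D m mhat G) {θ : E} (hθ : θ ∈ D)
    (x : ℝ) : P' {ω' | G θ ω' = x} = 0 := by
  have := nullSingletonClass_gaussianReal (μ := 0) (v := 1) one_ne_zero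
  rw [← measure_singleton (μ := gaussianReal 0 1) (x / √(∫ ω', (G θ ω') ^ 2 ∂P')),
    ← h.measure_standardized hθ (measurableSet_singleton _)]
  congr 1
  ext ω'
  simp only [mem_ofPred_eq, mem_singleton_iff]
  rw [div_left_inj' (h.sd_pos hθ).ne']

end Gaussian

/-- By right-continuity the cdf stays below p slightly to the right of 0. Since p < 1 the set is
nonempty, so its `sInf` is a genuine infimum. -/
lemma quantile_pos {μ : Measure ℝ} [IsProbabilityMeasure μ] {p : ℝ} (hp : p < 1)
    (hμ : μ.real (Iic 0) < p) : 0 < sInf {x : ℝ | p ≤ cdf μ x} := by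
  rw [← cdf_eq_real] at hμ
  have h1 : ∀ᶠ x in 𝓝[>] (0 : ℝ), cdf μ x < p :=
    (((cdf μ).right_continuous 0).mono Ioi_subset_Ici_self).eventually_lt_const hμ
  obtain ⟨x₀, hx₀, hx₀p⟩ := (h1.and self_mem_nhdsWithin).exists
  refine lt_of_lt_of_le (show (0 : ℝ) < x₀ from hx₀p) (le_csInf ?_ fun x hx => ?_)
  · obtain ⟨x, hx⟩ := ((tendsto_cdf_atTop μ).eventually_const_lt hp).exists
    exact ⟨x, hx.le⟩
  · by_contra! hlt
    exact absurd hx₀ (not_lt.2 ((show p ≤ cdf μ x from hx).trans (monotone_cdf μ hlt.le)))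

section Quantile

variable {Ω Ω' : Type*} [MeasurableSpace Ω] [MeasurableSpace Ω'] {P : Measure Ω}
  {P' : Measure Ω'} [IsProbabilityMeasure P']

lemma EstimatesAsymptoticQuantile.tendsto_inProb {k T : ℕ → Ω → ℝ} {p : ℝ} {V : Ω' → ℝ}
    (h : EstimatesAsymptoticQuantile P k T p) (hV : AEMeasurable V P')
    (hT : WeaklyConverges P T P' V) :
    Tendsto (fun x : ℕ × Ω => k x.1 x.2) (inProb P)
      (𝓝 (sInf {x : ℝ | p ≤ cdf (P'.map V) x})) :=
  (h _ ⟨P'.map V, Measure.isProbabilityMeasure_map hV, hT.map hV, rfl⟩).tendsto_inProb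

/-- Intervals far out are improbable by tightness; the remaining centres form a compact set, covered
by finitely many intervals of small limiting mass. Uniformity in x is essential, because the lemma
is applied at centres shifted by the drift √n m(θ_n), which need not converge. -/
lemma exists_concentration_lt [IsProbabilityMeasure P] {U : ℕ → Ω → ℝ} {V : Ω' → ℝ}
    (h : WeaklyConverges P U P' V) (hV : AEMeasurable V P') (hV0 : ∀ x, P' {ω' | V ω' = x} = 0)
    {ε : ℝ≥0∞} (hε : 0 < ε) :
    ∃ ρ : ℝ, 0 < ρ ∧ ∀ᶠ n in atTop, ∀ x : ℝ, P {ω | |U n ω - x| ≤ ρ} ≤ ε := by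
  obtain ⟨M, hM, hMε⟩ := exists_measure_abs_ge_lt hV hε
  have hball : ∀ x : ℝ, ∃ r : ℝ, 0 < r ∧ P' {ω' | |V ω' - x| ≤ r} < ε := by
    intro x
    have : IsProbabilityMeasure (P'.map V) := Measure.isProbabilityMeasure_map hV
    have h0 : P'.map V {x} < ε := by
      rw [Measure.map_apply_of_aemeasurable hV (measurableSet_singleton x)]
      exact (hV0 x).trans_lt hε
    obtain ⟨O, hxO, hO, hOε⟩ := Set.exists_isOpen_lt_of_lt _ _ h0
    obtain ⟨r, hr, hrO⟩ := Metric.nhds_basis_closedBall.mem_iff.1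
      (hO.mem_nhds (hxO (mem_singleton x)))
    refine ⟨r, hr, lt_of_le_of_lt ?_ hOε⟩
    rw [Measure.map_apply_of_aemeasurable hV hO.measurableSet]
    exact measure_mono fun ω' hω' => hrO (by rwa [mem_closedBall, Real.dist_eq])
  choose r hr hrε using hball
  obtain ⟨t, -, ht⟩ := (isCompact_Icc (a := -(M + 1)) (b := M + 1)).elim_nhds_subcover
    (fun x => ball x (r x / 2)) fun x _ => ball_mem_nhds x (half_pos (hr x))
  have hρ : ∀ᶠ ρ : ℝ in 𝓝[>] 0, ρ < 1 ∧ ∀ x ∈ t, ρ < r x / 2 :=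
    (eventually_nhdsWithin_of_eventually_nhds (gt_mem_nhds one_pos)).and
      ((Finset.eventually_all t).2 fun x _ =>
        eventually_nhdsWithin_of_eventually_nhds (gt_mem_nhds (half_pos (hr x))))
  obtain ⟨ρ, ⟨hρ1, hρt⟩, hρ0⟩ := (hρ.and self_mem_nhdsWithin).exists
  refine ⟨ρ, hρ0, ?_⟩
  have h1 := h.eventually_lt_of_isClosed hV (F := {y | M ≤ |y|})
    (isClosed_le continuous_const continuous_abs) hMε
  have h2 : ∀ᶠ n in atTop, ∀ x ∈ t, P {ω | |U n ω - x| ≤ r x} < ε :=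
    (Finset.eventually_all t).2 fun x _ =>
      h.eventually_lt_of_isClosed hV (F := {y | |y - x| ≤ r x})
        (isClosed_le (continuous_id.sub continuous_const).abs continuous_const) (hrε x)
  filter_upwards [h1, h2] with n hn1 hn2 x
  by_cases hx : x ∈ Icc (-(M + 1)) (M + 1)
  · obtain ⟨y, hy, hxy⟩ := mem_iUnion₂.1 (ht hx)
    refine le_trans (measure_mono fun ω hω => ?_) (hn2 y hy).le
    have h3 := hρt y hy
    rw [mem_ball, Real.dist_eq, abs_lt] at hxy
    have h4 := abs_le.1 (show |U n ω - x| ≤ ρ from hω)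
    refine show |U n ω - y| ≤ r y from abs_le.2 ⟨by linarith, by linarith⟩
  · refine le_trans (measure_mono fun ω hω => ?_) hn1.le
    have h4 := abs_le.1 (show |U n ω - x| ≤ ρ from hω)
    refine show M ≤ |U n ω| from ?_
    rw [mem_Icc, not_and_or, not_le, not_le] at hx
    rcases hx with hx | hx
    · exact le_abs.2 (Or.inr (by linarith))
    · exact le_abs.2 (Or.inl (by linarith))

end Quantile

/-! ### Similarity and invariance -/

section Decision

variable {Ω Ω' E : Type*} [MeasurableSpace Ω] [MeasurableSpace Ω'] [MetricSpace E]
  {P : Measure Ω} {P' : Measure Ω'} [IsProbabilityMeasure P] [IsProbabilityMeasure P']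
  {D Θ A B : Set E} {m b : E → ℝ} {mhat stat : ℕ → Ω → E → ℝ} {G : E → Ω' → ℝ}
  {k : ℕ → Ω → ℝ} {q : ℝ}

lemma weaklyConverges_stat [CompactSpace D] (h : ConditionR1 P P' D m mhat G)
    (hΘ : IsCompact Θ) (hΘD : Θ ⊆ D) (hb : ContinuousOn b Θ) (hb0 : ∀ θ ∈ Θ, 0 < b θ)
    (hratio : RatioApprox P Θ mhat stat b) (hstat : ∀ n ω θ, 0 ≤ stat n ω θ)
    {θ : E} (hθ : θ ∈ Θ) (hmθ : m θ = 0) :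
    AEMeasurable (fun ω' => (max (G θ ω') 0 / b θ) ^ 2) P' ∧
    WeaklyConverges P (fun n ω => stat n ω θ) P' (fun ω' => (max (G θ ω') 0 / b θ) ^ 2) := by
  obtain ⟨X, Y, hX, hY, hYG, hXY⟩ := h.exists_limit
  -- The statistic at a point is its supremum over a singleton.
  have h1 := (weaklyConverges_supStat h hX hY hXY hΘ hΘD hb hb0 hratio hstat
    (singleton_nonempty θ) (A := {θ}) (by simpa using hmθ) subset_rfl (by simpa using hθ)
    (by simpa using hmθ.le) fun r hr => ⟨1, one_pos, fun θ' hθ' _ =>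
      ⟨θ', hθ', by simpa using hr⟩⟩).2
  have hm := h.aemeasurable_limit (hΘD hθ)
  refine ⟨by fun_prop, fun f => ?_⟩
  have h2 : (fun n ω => stat n ω θ) = supStat {θ} stat := by
    funext n ω
    rw [supStat, image_singleton, csSup_singleton]
  rw [h2]
  convert h1 f using 2
  refine lintegral_congr_ae ?_
  filter_upwards [hYG] with ω' hω'
  have h3 := supScore_singleton (D := D) ⟨θ, hΘD hθ⟩ b (Y ω').toLInfty
  rw [ContinuousMap.toLInfty_apply, hω'] at h3
  simp only at h3
  rw [h3]

omit [MeasurableSpace Ω] [MetricSpace E] in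
lemma decision_eq_one_iff {n : ℕ} {ω : Ω} {θ : E} :
    decision stat k n ω θ = 1 ↔ stat n ω θ ≤ k n ω := by
  simp [decision]

/-- With b = c·sd(G) the limit is ([N]₊/c)² for a standard normal N, whatever the boundary point.
Its only atom is at 0, so q > 0 is a continuity point, and the limiting probability lies strictly
between 0 and 1. -/
lemma asymptoticallySimilar_decision [CompactSpace D] (h : ConditionR1 P P' D m mhat G)
    (hΘ : IsCompact Θ) (hΘD : Θ ⊆ D) (hb : ContinuousOn b Θ) (hb0 : ∀ θ ∈ Θ, 0 < b θ)
    (hratio : RatioApprox P Θ mhat stat b) (hstat : ∀ n ω θ, 0 ≤ stat n ω θ)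
    (hq : 0 < q) (hk : Tendsto (fun p : ℕ × Ω => k p.1 p.2) (inProb P) (𝓝 q))
    (hBΘ : B ⊆ Θ) (hBm : ∀ θ ∈ B, m θ = 0) (hbG : IsStandardDeviationWeight P' B b G) :
    AsymptoticallySimilar P B (decision stat k) := by
  obtain ⟨c, hc, hcb⟩ := hbG
  have hna := nullSingletonClass_gaussianReal (μ := 0) (v := 1) one_ne_zero
  set S : Set ℝ := {x | (max x 0 / c) ^ 2 ≤ q} with hS
  have hScl : IsClosed S := isClosed_le (by fun_prop) continuous_const
  have hS0 : 0 < gaussianReal 0 1 S := by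
    refine (gaussianReal_pos_of_isOpen isOpen_Iio ⟨-1, (by norm_num : (-1 : ℝ) < 0)⟩).trans_le
      (measure_mono fun x hx => ?_)
    rw [hS, mem_ofPred_eq, max_eq_right (show x < 0 from hx).le]
    simpa using hq.le
  have hS1 : gaussianReal 0 1 S < 1 := by
    have h1 : 0 < gaussianReal 0 1 Sᶜ := by
      refine gaussianReal_pos_of_isOpen hScl.isOpen_compl ⟨c * (√q + 1), ?_⟩
      have h2 : 0 < c * (√q + 1) := by positivity
      rw [hS, mem_compl_iff, mem_ofPred_eq, not_le, max_eq_left h2.le, mul_div_cancel_left₀ _ hc.ne']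
      nlinarith [Real.sq_sqrt hq.le, Real.sqrt_nonneg q]
    rw [prob_compl_eq_one_sub hScl.measurableSet] at h1
    exact tsub_pos_iff_lt.1 h1
  refine ⟨(gaussianReal 0 1 S).toReal, ENNReal.toReal_pos hS0.ne' hS1.ne_top, ?_, fun θ hθ => ?_⟩
  · rw [← ENNReal.toReal_one]
    exact (ENNReal.toReal_lt_toReal hS1.ne_top ENNReal.one_ne_top).2 hS1
  rw [ENNReal.ofReal_toReal hS1.ne_top]
  have hθD := hΘD (hBΘ hθ)
  have hsd := h.sd_pos hθD
  obtain ⟨hVm, hV⟩ := weaklyConverges_stat h hΘ hΘD hb hb0 hratio hstat (hBΘ hθ) (hBm θ hθ)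
  have hVeq : ∀ ω', max (G θ ω') 0 / b θ =
      max (G θ ω' / √(∫ ω', (G θ ω') ^ 2 ∂P')) 0 / c := fun ω' => by
    rw [hcb θ hθ, mul_comm c, ← div_div]
    congr 1
    rw [← max_div_div_right hsd.le, zero_div]
  -- Moving the error of the critical value into the statistic leaves the fixed threshold q.
  have hW : WeaklyConverges P (fun n ω => stat n ω θ - (k n ω - q)) P'
      (fun ω' => (max (G θ ω') 0 / b θ) ^ 2) := by
    refine hV.of_tendsto_sub hVm ?_
    have h1 : Tendsto (fun p : ℕ × Ω => -(k p.1 p.2 - q)) (inProb P) (𝓝 (-(q - q))) :=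
      (hk.sub tendsto_const_nhds).neg
    rw [sub_self, neg_zero] at h1
    refine h1.congr fun p => by ring
  have h0 : P' {ω' | (max (G θ ω') 0 / b θ) ^ 2 = q} = 0 := by
    rw [← measure_singleton (μ := gaussianReal 0 1) (c * √q),
      ← h.measure_standardized hθD (measurableSet_singleton _)]
    refine le_antisymm (measure_mono fun ω' hω' => ?_) ?_
    · rw [mem_ofPred_eq, hVeq] at hω'
      set x := G θ ω' / √(∫ ω', (G θ ω') ^ 2 ∂P') with hx
      have h2 : max x 0 / c = √q := by
        rw [← hω', Real.sqrt_sq (div_nonneg (le_max_right _ _) hc.le)]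
      have h3 : max x 0 = c * √q := by rw [← h2, mul_div_cancel₀ _ hc.ne']
      rw [mem_ofPred_eq, mem_singleton_iff, ← h3]
      refine (max_eq_left ?_).symm
      by_contra! hneg
      rw [max_eq_right hneg.le] at h3
      have := mul_pos hc (Real.sqrt_pos.2 hq)
      linarith
    · rw [h.measure_standardized hθD (measurableSet_singleton _), measure_singleton]
      exact zero_le
  have hlim := hW.tendsto_measure_le hVm h0
  have h4 : P' {ω' | (max (G θ ω') 0 / b θ) ^ 2 ≤ q} = gaussianReal 0 1 S := by
    rw [← h.measure_standardized hθD hScl.measurableSet]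
    congr 1
    ext ω'
    rw [mem_ofPred_eq, mem_ofPred_eq, hVeq, hS, mem_ofPred_eq]
  rw [h4] at hlim
  refine hlim.congr fun n => ?_
  congr 1
  ext ω
  simp only [mem_ofPred_eq, decision_eq_one_iff]
  constructor <;> intro h5 <;> linarith

omit [IsProbabilityMeasure P] in
lemma ConditionR1.eventually_abs_sub_lt [CompactSpace D] (h : ConditionR1 P P' D m mhat G)
    {ε : ℝ} (hε : 0 < ε) : ∀ᶠ p in inProb P, ∀ θ ∈ D, |mhat p.1 p.2 θ - m θ| < ε := by
  refine eventually_inProb_of_forall fun ε' hε' => ?_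
  obtain ⟨M, hM, hMε⟩ := h.exists_bound hε'
  refine ⟨fun p => ∀ θ ∈ D, |rootError m mhat p θ| ≤ M, hMε, ?_⟩
  filter_upwards [(tendsto_sqrt_natCast_mul_inProb hε).eventually_gt_atTop M] with p hp hM θ hθ
  have h1 := hM θ hθ
  rw [rootError, abs_mul, abs_of_nonneg (Real.sqrt_nonneg _)] at h1
  exact lt_of_mul_lt_mul_left (h1.trans_lt hp) (Real.sqrt_nonneg _)

-- Where the score is zero, a relative error bound leaves no room: the statistic vanishes exactly.
omit [MetricSpace E] [IsProbabilityMeasure P] in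
lemma RatioApprox.eventually_eq_zero (h : RatioApprox P Θ mhat stat b)
    (hstat : ∀ n ω θ, 0 ≤ stat n ω θ) :
    ∀ᶠ p in inProb P, ∀ θ ∈ Θ, mhat p.1 p.2 θ ≤ 0 → stat p.1 p.2 θ = 0 := by
  obtain ⟨κ, hκ, hev⟩ := h 1 one_pos
  filter_upwards [hev] with p hp θ hθ hm
  have h1 := hp θ hθ (hm.trans hκ.le)
  rw [positiveScore, max_eq_right hm] at h1
  simp only [mul_zero, zero_div, sub_zero] at h1
  exact (Real.sqrt_eq_zero (hstat _ _ _)).1 (abs_nonpos_iff.1 h1)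

omit [IsProbabilityMeasure P] in
lemma RatioApprox.eventually_threshold (h : RatioApprox P Θ mhat stat b) (hq : 0 < q)
    (hk : Tendsto (fun p : ℕ × Ω => k p.1 p.2) (inProb P) (𝓝 q))
    (hb : ContinuousOn b Θ) (hb0 : ∀ θ ∈ Θ, 0 < b θ) {θ₀ : E} (hθ₀ : θ₀ ∈ Θ) {θseq : ℕ → E}
    (hseq : ∀ n, θseq n ∈ Θ) (hlim : Tendsto θseq atTop (𝓝 θ₀))
    (hm : Tendsto (fun p : ℕ × Ω => mhat p.1 p.2 (θseq p.1)) (inProb P) (𝓝 0))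
    {ρ : ℝ} (hρ : 0 < ρ) (hρa : ρ < b θ₀ * √q) :
    ∀ᶠ p in inProb P,
      (√(p.1 : ℝ) * mhat p.1 p.2 (θseq p.1) < b θ₀ * √q - ρ →
        stat p.1 p.2 (θseq p.1) ≤ k p.1 p.2) ∧
      (b θ₀ * √q + ρ < √(p.1 : ℝ) * mhat p.1 p.2 (θseq p.1) →
        k p.1 p.2 < stat p.1 p.2 (θseq p.1)) := by
  set a := b θ₀ * √q with ha
  have hb₀ := hb0 θ₀ hθ₀
  have ha0 : 0 < a := mul_pos hb₀ (Real.sqrt_pos.2 hq)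
  have hab : a / b θ₀ = √q := by rw [ha, mul_div_cancel_left₀ _ hb₀.ne']
  -- Chosen so that e (a + ρ) = ρ/2, whence (1 + e)(a - ρ) < a < (1 - e)(a + ρ).
  set e := ρ / (2 * (a + ρ)) with he
  have he0 : 0 < e := by positivity
  have hea : e * (a + ρ) = ρ / 2 := by rw [he]; field_simp
  have he1 : e < 1 := by rw [he, div_lt_one (by positivity)]; linarith
  obtain ⟨κ, hκ, hev⟩ := h e he0
  have hbseq : Tendsto (fun p : ℕ × Ω => b (θseq p.1)) (inProb P) (𝓝 (b θ₀)) := by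
    have h1 : Tendsto θseq atTop (𝓝[Θ] θ₀) :=
      tendsto_nhdsWithin_iff.2 ⟨hlim, Eventually.of_forall hseq⟩
    exact ((hb θ₀ hθ₀).tendsto.comp h1).comp tendsto_fst_inProb
  have hsk : Tendsto (fun p : ℕ × Ω => √(k p.1 p.2)) (inProb P) (𝓝 (a / b θ₀)) := by
    rw [hab]
    exact hk.sqrt
  have hlow : ∀ᶠ p in inProb P, (1 + e) * (a - ρ) / b (θseq p.1) < √(k p.1 p.2) := by
    refine (tendsto_const_nhds.div hbseq hb₀.ne').eventually_lt hsk ?_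
    gcongr
    nlinarith
  have hhigh : ∀ᶠ p in inProb P, √(k p.1 p.2) < (1 - e) * (a + ρ) / b (θseq p.1) := by
    refine hsk.eventually_lt (tendsto_const_nhds.div hbseq hb₀.ne') ?_
    gcongr
    nlinarith
  filter_upwards [hev, hlow, hhigh, hk.eventually_const_lt hq, hm.eventually_le_const hκ]
    with p hp hl hh hkp hmp
  have hbp := hb0 _ (hseq p.1)
  have h1 := abs_le.1 (hp _ (hseq p.1) hmp)
  have hR : positiveScore mhat b p (θseq p.1) =
      max (√(p.1 : ℝ) * mhat p.1 p.2 (θseq p.1)) 0 / b (θseq p.1) := by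
    rw [positiveScore, mul_max_of_nonneg _ _ (Real.sqrt_nonneg _), mul_zero]
  constructor
  · intro hy
    have h2 : positiveScore mhat b p (θseq p.1) ≤ (a - ρ) / b (θseq p.1) := by
      rw [hR]
      gcongr
      exact max_le hy.le (by linarith)
    have h3 : √(stat p.1 p.2 (θseq p.1)) ≤ √(k p.1 p.2) := by
      rw [mul_div_assoc] at hl
      nlinarith
    exact (Real.sqrt_le_sqrt_iff hkp.le).1 h3
  · intro hy
    have h2 : (a + ρ) / b (θseq p.1) ≤ positiveScore mhat b p (θseq p.1) := by
      rw [hR]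
      gcongr
      exact hy.le.trans (le_max_left _ _)
    have h3 : √(k p.1 p.2) < √(stat p.1 p.2 (θseq p.1)) := by
      rw [mul_div_assoc] at hh
      nlinarith
    exact (Real.sqrt_lt_sqrt_iff hkp.le).1 h3

lemma eventually_decision_eq [CompactSpace D] (h : ConditionR1 P P' D m mhat G)
    (hm : ContinuousOn m D) (hΘD : Θ ⊆ D) {b₁ b₂ : E → ℝ} {stat₁ stat₂ : ℕ → Ω → E → ℝ}
    {k₁ k₂ : ℕ → Ω → ℝ}
    (hb₁ : ContinuousOn b₁ Θ) (hb₁0 : ∀ θ ∈ Θ, 0 < b₁ θ)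
    (hb₂ : ContinuousOn b₂ Θ) (hb₂0 : ∀ θ ∈ Θ, 0 < b₂ θ)
    (hratio₁ : RatioApprox P Θ mhat stat₁ b₁) (hratio₂ : RatioApprox P Θ mhat stat₂ b₂)
    (hdiv₁ : DivergesAbove P Θ mhat stat₁) (hdiv₂ : DivergesAbove P Θ mhat stat₂)
    (hstat₁ : ∀ n ω θ, 0 ≤ stat₁ n ω θ) (hstat₂ : ∀ n ω θ, 0 ≤ stat₂ n ω θ) (hq : 0 < q)
    (hk₁ : Tendsto (fun p : ℕ × Ω => k₁ p.1 p.2) (inProb P) (𝓝 q))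
    (hk₂ : Tendsto (fun p : ℕ × Ω => k₂ p.1 p.2) (inProb P) (𝓝 q))
    (hbb : ∀ θ ∈ identifiedBoundary Θ m, b₁ θ = b₂ θ) {θ₀ : E} (hθ₀ : θ₀ ∈ Θ) {θseq : ℕ → E}
    (hseq : ∀ n, θseq n ∈ Θ) (hlim : Tendsto θseq atTop (𝓝 θ₀)) :
    ∀ᶠ p in inProb P, (stat₁ p.1 p.2 (θseq p.1) ≤ k₁ p.1 p.2 ↔
      stat₂ p.1 p.2 (θseq p.1) ≤ k₂ p.1 p.2) := by
  have hmseq : Tendsto (fun n => m (θseq n)) atTop (𝓝 (m θ₀)) :=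
    (hm θ₀ (hΘD hθ₀)).tendsto.comp
      (tendsto_nhdsWithin_iff.2 ⟨hlim, Eventually.of_forall fun n => hΘD (hseq n)⟩)
  have hmhat : Tendsto (fun p : ℕ × Ω => mhat p.1 p.2 (θseq p.1)) (inProb P) (𝓝 (m θ₀)) := by
    have h1 : Tendsto (fun p : ℕ × Ω => mhat p.1 p.2 (θseq p.1) - m (θseq p.1)) (inProb P)
        (𝓝 0) := by
      rw [Metric.tendsto_nhds]
      intro ε hε
      filter_upwards [h.eventually_abs_sub_lt hε] with p hp
      simpa using hp _ (hΘD (hseq p.1))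
    simpa using h1.add (hmseq.comp tendsto_fst_inProb)
  rcases lt_trichotomy (m θ₀) 0 with hneg | hzero | hpos
  · filter_upwards [hmhat.eventually_le_const hneg, hratio₁.eventually_eq_zero hstat₁,
      hratio₂.eventually_eq_zero hstat₂, hk₁.eventually_const_lt hq, hk₂.eventually_const_lt hq]
      with p h1 h2 h3 h4 h5
    rw [h2 _ (hseq _) h1, h3 _ (hseq _) h1]
    exact ⟨fun _ => h5.le, fun _ => h4.le⟩
  · refine eventually_inProb_of_forall fun ε' hε' => ?_
    have hθ₀B : θ₀ ∈ identifiedBoundary Θ m := ⟨hθ₀, hzero⟩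
    have hb₁₀ := hb₁0 θ₀ hθ₀
    obtain ⟨X, Y, hX, hY, hYG, hXY⟩ := h.exists_limit
    set a := b₁ θ₀ * √q with ha
    have ha0 : 0 < a := mul_pos hb₁₀ (Real.sqrt_pos.2 hq)
    have hGm := h.aemeasurable_limit (hΘD hθ₀)
    -- Equicontinuity moves the root error from θ_n to θ₀.
    have hU : WeaklyConverges P (fun n ω => rootError m mhat (n, ω) (θseq n)) P' (G θ₀) := by
      have hcont : Continuous fun x : LInfty D => x ⟨θ₀, hΘD hθ₀⟩ := by
        refine (LipschitzWith.of_le_add_mul 1 fun x y => ?_).continuous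
        have := (abs_le.1 (LInfty.abs_sub_le_dist x y ⟨θ₀, hΘD hθ₀⟩)).2
        rw [NNReal.coe_one, one_mul]
        linarith
      have hX₀ : WeaklyConverges P (fun n ω => X n ω ⟨θ₀, hΘD hθ₀⟩) P' (G θ₀) := by
        intro f
        convert hXY.comp hcont f using 2
        refine lintegral_congr_ae ?_
        filter_upwards [hYG] with ω' hω'
        rw [ContinuousMap.toLInfty_apply, hω']
      refine hX₀.of_tendsto_sub hGm ?_
      rw [Metric.tendsto_nhds]
      intro ε hε
      refine eventually_inProb_of_forall fun ε'' hε'' => ?_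
      obtain ⟨r, hr, hequi⟩ := h.exists_equicontinuous (half_pos hε) hε''
      refine ⟨fun p => ∀ θ ∈ D, ∀ θ' ∈ D, dist θ θ' < r →
        |rootError m mhat p θ - rootError m mhat p θ'| ≤ ε / 2, hequi, ?_⟩
      filter_upwards [hX, (hlim.comp tendsto_fst_inProb).eventually (ball_mem_nhds θ₀ hr)]
        with p hXp hd hp
      rw [hXp, dist_zero_right, Real.norm_eq_abs]
      exact (hp _ (hΘD (hseq p.1)) _ (hΘD hθ₀) hd).trans_lt (half_lt_self hε)
    obtain ⟨ρ, hρ, hconc⟩ := exists_concentration_lt hU hGm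
      (fun x => h.measure_eq_zero (hΘD hθ₀) x) hε'
    set ρ' := min ρ (a / 2) with hρ'
    have hρ'0 : 0 < ρ' := by positivity
    have hρ'a : ρ' < a := (min_le_right _ _).trans_lt (half_lt_self ha0)
    refine ⟨fun p => ¬ |√(p.1 : ℝ) * mhat p.1 p.2 (θseq p.1) - a| ≤ ρ', ?_, ?_⟩
    · filter_upwards [hconc] with n hn
      -- The deterministic drift √n m(θ_n) is absorbed into the centre of the interval.
      refine le_trans (measure_mono fun ω hω => ?_) (hn (a - √(n : ℝ) * m (θseq n)))
      have h1 := (not_not.1 hω).trans (min_le_left _ _)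
      refine le_trans (le_of_eq ?_) h1
      simp only [rootError]
      congr 1
      ring
    · rw [hzero] at hmhat
      have e₁ := hratio₁.eventually_threshold hq hk₁ hb₁ hb₁0 hθ₀ hseq hlim hmhat hρ'0
        hρ'a
      have e₂ := hratio₂.eventually_threshold hq hk₂ hb₂ hb₂0 hθ₀ hseq hlim hmhat hρ'0
        (by rwa [← hbb θ₀ hθ₀B])
      rw [← hbb θ₀ hθ₀B] at e₂
      filter_upwards [e₁, e₂] with p h1 h2 hA
      rw [not_le, lt_abs] at hA
      rcases hA with hA | hA
      · have hA' : a + ρ' < √(p.1 : ℝ) * mhat p.1 p.2 (θseq p.1) := by linarith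
        exact iff_of_false (not_le.2 (h1.2 hA')) (not_le.2 (h2.2 hA'))
      · have hA' : √(p.1 : ℝ) * mhat p.1 p.2 (θseq p.1) < a - ρ' := by linarith
        exact iff_of_true (h1.1 hA') (h2.1 hA')
  · filter_upwards [hmhat.eventually_const_lt (half_lt_self hpos),
      hdiv₁ _ (half_pos hpos) (q + 1), hdiv₂ _ (half_pos hpos) (q + 1),
      hk₁.eventually_lt_const (lt_add_one q), hk₂.eventually_lt_const (lt_add_one q)]
      with p h1 h2 h3 h4 h5
    exact iff_of_false (not_le.2 (h4.trans (h2 _ (hseq _) h1)))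
      (not_le.2 (h5.trans (h3 _ (hseq _) h1)))

end Decision

/-! ### Congruence of the conditions -/

section Congr

variable {Ω Ω' E : Type*} [MeasurableSpace Ω] [MeasurableSpace Ω'] {P : Measure Ω}
  {P' : Measure Ω'} {D : Set E} {m m' : E → ℝ} {mhat mhat' : ℕ → Ω → E → ℝ}

lemma ConditionR1.congr [TopologicalSpace E] {G : E → Ω' → ℝ} (h : ConditionR1 P P' D m mhat G)
    (hm : EqOn m' m D) (hmhat : ∀ n ω, EqOn (mhat' n ω) (mhat n ω) D) :
    ConditionR1 P P' D m' mhat' G := by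
  refine ⟨h.gaussian, h.centered, h.continuous_paths, h.nondegenerate, ?_⟩
  obtain ⟨X, Y, hX, hY, hXY⟩ := h.weak_limit
  refine ⟨X, Y, fun n => ?_, hY, hXY⟩
  filter_upwards [hX n] with ω hω θ
  rw [hω, hm θ.2, hmhat n ω θ.2]

lemma ConditionR3.congr [TopologicalSpace E] (h : ConditionR3 P D m mhat)
    (hm : EqOn m' m D) (hmhat : ∀ n ω, EqOn (mhat' n ω) (mhat n ω) D) :
    ConditionR3 P D m' mhat' := by
  refine ⟨fun ε hε => ?_, h.continuous.congr hm, ?_⟩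
  · convert h.consistent ε hε using 4 with n
    ext ω
    refine exists_congr fun θ => and_congr_right fun hθ => ?_
    rw [hm hθ, hmhat n ω hθ]
  · obtain ⟨c, hc, hcm⟩ := h.bound
    exact ⟨c, hc, fun θ hθ => by rw [hm hθ]; exact hcm θ hθ⟩

lemma ConditionR2.congr [NormedAddCommGroup E] [InnerProductSpace ℝ E] [CompleteSpace E]
    (h : ConditionR2 P D m mhat) (hm : EqOn m' m D)
    (hmhat : ∀ n ω, EqOn (mhat' n ω) (mhat n ω) D) : ConditionR2 P D m' mhat' := by
  have key : ∀ {f g : E → ℝ}, EqOn f g D → EqOn (gradientWithin f D) (gradientWithin g D) D :=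
    fun hfg θ hθ => by rw [gradientWithin, gradientWithin, fderivWithin_congr' hfg hθ]
  refine ⟨h.differentiable.congr hm, h.continuous_gradient.congr (key hm), fun n => ?_,
    fun n => ?_, fun ε hε => ?_, ?_, ?_⟩
  · filter_upwards [h.differentiable_hat n] with ω hω
    exact hω.congr (hmhat n ω)
  · filter_upwards [h.continuous_gradient_hat n] with ω hω
    exact hω.congr (key (hmhat n ω))
  · convert h.consistent ε hε using 4 with n
    ext ω
    refine exists_congr fun θ => and_congr_right fun hθ => ?_
    simp only [key hm hθ, key (hmhat n ω) hθ]
  · obtain ⟨L, hL⟩ := h.lipschitz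
    refine ⟨L, fun x hx y hy => ?_⟩
    rw [key hm hx, key hm hy]
    exact hL hx hy
  · obtain ⟨c, hc, hcm⟩ := h.gradient_bound
    exact ⟨c, hc, fun θ hθ => by rw [key hm hθ]; exact hcm θ hθ⟩

end Congr

/-! ### Transformations of the parameter -/

lemma transformed_apply {E F : Type*} [Nonempty E] {D : Set E} {η : E → E} (hη : InjOn η D)
    (f : E → F) {θ : E} (hθ : θ ∈ D) : transformed D η f (η θ) = f θ := by
  rw [transformed, hη.leftInvOn_invFunOn hθ]

section Image

variable {Ω E : Type*} [MeasurableSpace Ω] {P : Measure Ω} {Θ : Set E} {mhat : ℕ → Ω → E → ℝ}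

lemma RatioApprox.of_image {η : E → E} {mhat' stat stat' : ℕ → Ω → E → ℝ} {b : E → ℝ}
    (h : RatioApprox P (η '' Θ) mhat' stat' b)
    (hm : ∀ n ω, ∀ θ ∈ Θ, mhat' n ω (η θ) = mhat n ω θ)
    (hs : ∀ n ω, ∀ θ ∈ Θ, stat' n ω (η θ) = stat n ω θ) :
    RatioApprox P Θ mhat stat (fun θ => b (η θ)) := by
  intro ε hε
  obtain ⟨κ, hκ, hev⟩ := h ε hε
  refine ⟨κ, hκ, ?_⟩
  filter_upwards [hev] with p hp θ hθ hθκ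
  have := hp (η θ) (mem_image_of_mem _ hθ) (by rwa [hm _ _ θ hθ])
  rw [hs _ _ θ hθ, positiveScore, hm _ _ θ hθ] at this
  exact this

lemma DivergesAbove.of_image {η : E → E} {mhat' stat stat' : ℕ → Ω → E → ℝ}
    (h : DivergesAbove P (η '' Θ) mhat' stat')
    (hm : ∀ n ω, ∀ θ ∈ Θ, mhat' n ω (η θ) = mhat n ω θ)
    (hs : ∀ n ω, ∀ θ ∈ Θ, stat' n ω (η θ) = stat n ω θ) :
    DivergesAbove P Θ mhat stat := by
  intro κ hκ M
  filter_upwards [h κ hκ M] with p hp θ hθ hθκ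
  have := hp (η θ) (mem_image_of_mem _ hθ) (by rwa [hm _ _ θ hθ])
  rwa [hs _ _ θ hθ] at this

end Image

section Transform

variable {Ω Ω' E : Type*} [MeasurableSpace Ω] [MeasurableSpace Ω'] [NormedAddCommGroup E]
  [InnerProductSpace ℝ E] [CompleteSpace E] {P : Measure Ω} {P' : Measure Ω'} {Θ : Set E} {δ : ℝ}
  {m s w : E → ℝ} {mhat shat : ℕ → Ω → E → ℝ} {what : (E → E) → ℕ → Ω → E → ℝ} {G : E → Ω' → ℝ}

/-- Makes the untransformed Wald statistic the case η = id. Transforming by `id` preserves functions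
only on the expansion, hence the congruence lemmas. -/
lemma id_mem_admissibleTransformations
    (h : ConditionR P P' Θ δ m mhat s shat w (what id) G) :
    id ∈ admissibleTransformations P P' Θ δ m mhat s shat what := by
  have hid : InjOn (id : E → E) (cthickening δ Θ) := injOn_id _
  have key : ∀ f : E → ℝ, EqOn (transformed (cthickening δ Θ) id f) f (cthickening δ Θ) :=
    fun f θ hθ => transformed_apply hid f hθ
  refine ⟨hid, contDiffOn_id, δ, w, G, ?_, ?_⟩
  · rw [image_id, image_id]
  · rw [image_id]
    exact ⟨h.pos, h.r1.congr (key _) fun _ _ => key _, h.r2.congr (key _) fun _ _ => key _,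
      h.r3_s.congr (key _) fun _ _ => key _, h.r3_w.congr (fun _ _ => rfl) fun _ _ => key _⟩

omit [MeasurableSpace Ω] [InnerProductSpace ℝ E] [CompleteSpace E] in
lemma waldStatT_id (D : Set E) : waldStatT D mhat what id = waldStat D mhat (what id) := by
  funext n ω θ
  simp [waldStatT, waldStat]

/-- The transformed Wald statistic is asymptotically equivalent to the positive part of the
moment, with a weight that is determined by the limiting weighting function. -/
lemma exists_waldStatT_weight [ProperSpace E] [IsProbabilityMeasure P] (hΘ : IsCompact Θ)
    {η : E → E} (hη : η ∈ admissibleTransformations P P' Θ δ m mhat s shat what)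
    {θ₀ : E} (hθ₀ : θ₀ ∈ Θ)
    (hm : Tendsto (fun p : ℕ × Ω => mhat p.1 p.2 θ₀) (inProb P) (𝓝 0)) :
    ∃ b : E → ℝ, ContinuousOn b Θ ∧ (∀ θ ∈ Θ, 0 < b θ) ∧
      RatioApprox P Θ mhat (waldStatT (cthickening δ Θ) mhat what η) b ∧
      DivergesAbove P Θ mhat (waldStatT (cthickening δ Θ) mhat what η) ∧
      ∀ (B : Set E) (t : ℕ → Ω → E → ℝ) (t₀ : E → ℝ), B ⊆ Θ →
        HasWeightForm P (cthickening δ Θ) B m what η t →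
        (∀ θ ∈ B, Tendsto (fun p : ℕ × Ω => t p.1 p.2 θ) (inProb P) (𝓝 (t₀ θ))) →
        ∀ θ ∈ B, b θ = t₀ θ := by
  obtain ⟨hinj, hcd, δ', w', G', hsub, hR⟩ := hη
  set D := cthickening δ Θ with hD
  set D' := cthickening δ' (η '' Θ) with hD'
  have hΘD : Θ ⊆ D := self_subset_cthickening Θ
  have hηc : ContinuousOn η Θ := hcd.continuousOn.mono hΘD
  have hmaps : MapsTo η Θ D' := fun θ hθ => self_subset_cthickening _ (mem_image_of_mem _ hθ)
  -- By injectivity, the image of the estimated set is, within D', the sublevel set of the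
  -- transformed moment.
  have hS : ∀ n ω, ∀ y ∈ D', y ∈ η '' identifiedSet D (mhat n ω) ↔
      transformed D η (mhat n ω) y ≤ 0 := by
    intro n ω y hy
    obtain ⟨θ, hθ, rfl⟩ := hsub hy
    rw [transformed_apply hinj _ hθ]
    constructor
    · rintro ⟨θ', hθ', he⟩
      rw [← hinj hθ'.1 hθ he]
      exact hθ'.2
    · exact fun h => ⟨θ, ⟨hθ, h⟩, rfl⟩
  have hmη : ∀ n ω, ∀ θ ∈ Θ, transformed D η (mhat n ω) (η θ) = mhat n ω θ :=
    fun n ω θ hθ => transformed_apply hinj _ (hΘD hθ)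
  have hsη : ∀ (n : ℕ) (ω : Ω), ∀ θ ∈ Θ, (√(n : ℝ) * infDist (η θ) (η '' identifiedSet D (mhat n ω)) /
      transformed D η (what η n ω) (η θ)) ^ 2 = waldStatT D mhat what η n ω θ :=
    fun n ω θ hθ => by rw [transformed_apply hinj _ (hΘD hθ), waldStatT]
  have hratio := waldStat_ratioApprox hR.r2 hR.r3_w hR.pos hS
  have hdiv := waldStat_divergesAbove (hΘ.image_of_continuousOn hηc) hR.r2 hR.r3_w hR.pos hS
    (mem_image_of_mem η hθ₀) (by simpa only [hmη _ _ θ₀ hθ₀] using hm)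
  obtain ⟨c, hc, hcm⟩ := hR.r2.gradient_bound
  refine ⟨fun θ => w' (η θ) * ‖gradientWithin (transformed D η m) D' (η θ)‖, ?_, fun θ hθ => ?_,
    hratio.of_image hmη hsη, hdiv.of_image hmη hsη, ?_⟩
  · exact (hR.r3_w.continuous.comp hηc hmaps).mul
      (hR.r2.continuous_gradient.comp hηc hmaps).norm
  · exact mul_pos (hR.r3_w.pos (hmaps hθ)) (hc.trans_le (hcm _ (hmaps hθ)))
  · intro B t t₀ hBΘ hform ht θ hθ
    have hθΘ := hBΘ hθ
    have hnhds : D' ∈ 𝓝 (η θ) :=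
      mem_of_superset (ball_mem_nhds _ hR.pos)
        (ball_subset_cthickening_of_mem (mem_image_of_mem _ hθΘ) le_rfl)
    have hgrad : gradientWithin (transformed D η m) D' (η θ) =
        gradient (transformed D η m) (η θ) := by
      rw [gradientWithin, gradient, fderivWithin_of_mem_nhds hnhds]
    have hgpos : 0 < ‖gradientWithin (transformed D η m) D' (η θ)‖ :=
      hc.trans_le (hcm _ (hmaps hθΘ))
    have h1 : Tendsto (fun p : ℕ × Ω => what η p.1 p.2 θ) (inProb P) (𝓝 (w' (η θ))) := by
      rw [Metric.tendsto_nhds]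
      intro ε hε
      filter_upwards [hR.r3_w.consistent.eventually hε] with p hp
      have := hp (η θ) (hmaps hθΘ)
      rwa [transformed_apply hinj _ (hΘD hθΘ)] at this
    have h2 := (hform θ hθ).tendsto_inProb
    rw [← hgrad] at h2
    have h3 := h1.sub ((ht θ hθ).div_const ‖gradientWithin (transformed D η m) D' (η θ)‖)
    -- The weight minus its prescribed form has two limits in probability, which must agree.
    have h4 := tendsto_nhds_unique h3 h2
    have h5 : w' (η θ) = t₀ θ / ‖gradientWithin (transformed D η m) D' (η θ)‖ := by linarith
    simp only
    rw [h5, div_mul_cancel₀ _ hgpos.ne']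

end Transform

/-! ### Critical values -/

/-- On the compact set `Θ` minus the r-neighbourhood of the boundary, |m| has no zero and so is
bounded below. -/
lemma exists_boundary_near {E : Type*} [MetricSpace E] {Θ : Set E} (hΘ : IsCompact Θ) {m : E → ℝ}
    (hm : ContinuousOn m Θ) {r : ℝ} (hr : 0 < r) :
    ∃ κ : ℝ, 0 < κ ∧ ∀ θ ∈ identifiedSet Θ m, -κ < m θ →
      ∃ θ' ∈ identifiedBoundary Θ m, dist θ θ' < r := by
  obtain ⟨κ, hκ, hle⟩ := (hΘ.diff isOpen_thickening).exists_pos_forall_le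
    (b := fun θ => |m θ|) (hm.abs.mono sdiff_subset)
    (fun θ (hθ : θ ∈ Θ \ thickening r (identifiedBoundary Θ m)) =>
      abs_pos.2 fun h0 => hθ.2 (self_subset_thickening hr _ ⟨hθ.1, h0⟩))
  refine ⟨κ, hκ, fun θ hθ hθm => ?_⟩
  by_contra! hcon
  have h1 : θ ∉ thickening r (identifiedBoundary Θ m) := fun h2 => by
    obtain ⟨θ', hθ', hd⟩ := mem_thickening_iff.1 h2
    exact absurd hd (not_lt.2 (hcon θ' hθ'))
  have h3 := hle θ ⟨hθ.1, h1⟩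
  rw [abs_of_nonpos hθ.2] at h3
  linarith

section Critical

variable {Ω Ω' E : Type*} [MeasurableSpace Ω] [MeasurableSpace Ω'] [MetricSpace E]
  {P : Measure Ω} {P' : Measure Ω'} [IsProbabilityMeasure P] [IsProbabilityMeasure P']
  {D Θ A : Set E} {m b : E → ℝ} {mhat stat : ℕ → Ω → E → ℝ} {G : E → Ω' → ℝ}
  {k : ℕ → Ω → ℝ} {X : ℕ → Ω → LInfty D}

/-- For positivity: if the limiting supremum is at most 0, then G(θ) ≤ 0 at any given boundary
point, an event of probability at most 1/2 < 1 - α. -/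
lemma tendsto_criticalValue [CompactSpace D] (h : ConditionR1 P P' D m mhat G) {Y : Ω' → C(D, ℝ)}
    (hX : ∀ᶠ p in inProb P, ∀ θ : D, X p.1 p.2 θ = rootError m mhat p θ) (hY : AEMeasurable Y P')
    (hYG : ∀ᵐ ω' ∂P', ∀ θ : D, Y ω' θ = G θ ω')
    (hXY : WeaklyConverges P X P' fun ω' => (Y ω').toLInfty)
    (hm : ContinuousOn m D) (hΘ : IsCompact Θ) (hΘD : Θ ⊆ D)
    (hB : (identifiedBoundary Θ m).Nonempty)
    (hb : ContinuousOn b Θ) (hb0 : ∀ θ ∈ Θ, 0 < b θ)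
    (hratio : RatioApprox P Θ mhat stat b) (hstat : ∀ n ω θ, 0 ≤ stat n ω θ)
    (hBA : identifiedBoundary Θ m ⊆ A) (hA : A ⊆ identifiedSet Θ m) {α : ℝ} (hα0 : 0 < α)
    (hα : α < 1 / 2) (hk : EstimatesAsymptoticQuantile P k (supStat A stat) (1 - α)) :
    0 < sInf {x : ℝ | 1 - α ≤ cdf (P'.map fun ω' =>
        supScore (identifiedBoundary Θ m) b (Y ω').toLInfty ^ 2) x} ∧
    Tendsto (fun p : ℕ × Ω => k p.1 p.2) (inProb P)
      (𝓝 (sInf {x : ℝ | 1 - α ≤ cdf (P'.map fun ω' =>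
        supScore (identifiedBoundary Θ m) b (Y ω').toLInfty ^ 2) x})) := by
  obtain ⟨hVm, hV⟩ := weaklyConverges_supStat h hX hY hXY hΘ hΘD hb hb0 hratio hstat hB
    (fun θ hθ => hθ.2) hBA (fun θ hθ => (hA hθ).1) (fun θ hθ => (hA hθ).2) fun r hr => by
      obtain ⟨κ, hκ, hnear⟩ := exists_boundary_near hΘ (hm.mono hΘD) hr
      exact ⟨κ, hκ, fun θ hθ => hnear θ (hA hθ)⟩
  refine ⟨?_, hk.tendsto_inProb hVm hV⟩
  have := Measure.isProbabilityMeasure_map hVm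
  refine quantile_pos (by linarith) (lt_of_le_of_lt ?_ (show (1 / 2 : ℝ) < 1 - α by linarith))
  obtain ⟨θ, hθ⟩ := hB
  obtain ⟨c, hc, hcb⟩ := hΘ.exists_pos_forall_le hb hb0
  have hle : P'.map (fun ω' => supScore (identifiedBoundary Θ m) b (Y ω').toLInfty ^ 2) (Iic 0) ≤
      1 / 2 := by
    rw [Measure.map_apply_of_aemeasurable hVm measurableSet_Iic]
    refine le_trans (measure_mono_ae ?_) (h.measure_nonpos_le (hΘD hθ.1))
    filter_upwards [hYG] with ω' hω' hle
    have h1 : supScore (identifiedBoundary Θ m) b (Y ω').toLInfty = 0 :=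
      pow_eq_zero_iff two_ne_zero |>.1 (le_antisymm hle (sq_nonneg _))
    have h2 := le_supScore (D := D) hc (fun θ hθ => hcb θ hθ.1) (Y ω').toLInfty
      (θ := ⟨θ, hΘD hθ.1⟩) hθ
    rw [h1, ContinuousMap.toLInfty_apply, hω', div_le_iff₀ (hb0 θ hθ.1), zero_mul] at h2
    exact (le_max_left _ _).trans h2
  have h3 := ENNReal.toReal_mono (by simp) hle
  simpa [Measure.real] using h3

end Critical

/-! ### Proof of the proposition -/

lemma RatioApprox.mono {Ω E : Type*} [MeasurableSpace Ω] {P : Measure Ω} {Θ D : Set E}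
    {mhat stat : ℕ → Ω → E → ℝ} {b : E → ℝ} (h : RatioApprox P D mhat stat b) (hΘ : Θ ⊆ D) :
    RatioApprox P Θ mhat stat b := by
  intro ε hε
  obtain ⟨κ, hκ, hev⟩ := h ε hε
  exact ⟨κ, hκ, hev.mono fun p hp θ hθ => hp θ (hΘ hθ)⟩

theorem proposition3 {Ω Ω' : Type*} [MeasurableSpace Ω] [MeasurableSpace Ω']
    (P : Measure Ω) [IsProbabilityMeasure P] (P' : Measure Ω') [IsProbabilityMeasure P']
    (d : ℕ) (Θ : Set (EuclideanSpace ℝ (Fin d))) (hΘ : IsCompact Θ) (δ : ℝ)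
    (m : EuclideanSpace ℝ (Fin d) → ℝ) (mhat : ℕ → Ω → EuclideanSpace ℝ (Fin d) → ℝ)
    (s : EuclideanSpace ℝ (Fin d) → ℝ) (shat : ℕ → Ω → EuclideanSpace ℝ (Fin d) → ℝ)
    (w : EuclideanSpace ℝ (Fin d) → ℝ)
    -- `what η` is the weight `ŵ(·;η)`; the untransformed weight is `what id`
    (what : (EuclideanSpace ℝ (Fin d) → EuclideanSpace ℝ (Fin d)) →
      ℕ → Ω → EuclideanSpace ℝ (Fin d) → ℝ)
    (G : EuclideanSpace ℝ (Fin d) → Ω' → ℝ)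
    (hR : ConditionR P P' Θ δ m mhat s shat w (what id) G)
    (hB : (identifiedBoundary Θ m).Nonempty)
    (α : ℝ) (hα0 : 0 < α) (hα : α < 1 / 2)
    -- the rule that turns a random LR statistic on `Θ` into a critical value
    (kL : ℕ → (Ω → Θ → ℝ) → Ω → ℝ)
    (hkL : EstimatesAsymptoticQuantile P (fun n => kL n (fun ω θ => lrStat mhat shat n ω θ))
      (supStat (identifiedSet Θ m) (lrStat mhat shat)) (1 - α))
    -- critical values for the Wald statistic, untransformed and transformed
    (kW : ℕ → Ω → ℝ)
    (hkW : EstimatesAsymptoticQuantile P kW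
      (supStat (identifiedSet Θ m) (waldStat (cthickening δ Θ) mhat (what id))) (1 - α))
    (kWT : (EuclideanSpace ℝ (Fin d) → EuclideanSpace ℝ (Fin d)) → ℕ → Ω → ℝ)
    (hkWT : ∀ η ∈ admissibleTransformations P P' Θ δ m mhat s shat what,
      EstimatesAsymptoticQuantile P (kWT η)
        (supStat (identifiedBoundary Θ m) (waldStatT (cthickening δ Θ) mhat what η)) (1 - α)) :
    let H := admissibleTransformations P P' Θ δ m mhat s shat what
    let φL := decision (lrStat mhat shat) (fun n => kL n (fun ω θ => lrStat mhat shat n ω θ))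
    let φLT := fun η => decision (lrStatT (cthickening δ Θ) mhat shat η)
      (fun n => kL n (fun ω θ => lrStatT (cthickening δ Θ) mhat shat η n ω θ))
    let φW := decision (waldStat (cthickening δ Θ) mhat (what id)) kW
    let φWT := fun η => decision (waldStatT (cthickening δ Θ) mhat what η) (kWT η)
    -- (i)
    Invariant Θ H φL φLT ∧
    (IsStandardDeviationWeight P' (identifiedBoundary Θ m) s G →
      AsymptoticallySimilar P (identifiedBoundary Θ m) φL ∧
      ∀ η ∈ H, AsymptoticallySimilar P (identifiedBoundary Θ m) (φLT η)) ∧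
    -- (ii)
    (∀ b : EuclideanSpace ℝ (Fin d) → ℝ, (∀ θ ∈ identifiedBoundary Θ m, 0 < b θ) →
      (∀ η ∈ H, HasWeightForm P (cthickening δ Θ) (identifiedBoundary Θ m) m what η
        (fun _ _ θ => b θ)) →
      AsymptoticallyInvariant P Θ H φW φWT) ∧
    -- (iii)
    (IsStandardDeviationWeight P' (identifiedBoundary Θ m) s G →
      ∀ b : ℝ, 0 < b →
        (HasWeightForm P (cthickening δ Θ) (identifiedBoundary Θ m) m what id
          (fun n ω θ => b * shat n ω θ) →
          AsymptoticallySimilar P (identifiedBoundary Θ m) φW) ∧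
        ∀ η ∈ H, HasWeightForm P (cthickening δ Θ) (identifiedBoundary Θ m) m what η
          (fun n ω θ => b * shat n ω θ) →
          AsymptoticallySimilar P (identifiedBoundary Θ m) (φWT η)) := by
  intro H φL φLT φW φWT
  have hDc : IsCompact (cthickening δ Θ) := hΘ.cthickening
  have : CompactSpace (cthickening δ Θ) := isCompact_iff_compactSpace.1 hDc
  have hΘD : Θ ⊆ cthickening δ Θ := self_subset_cthickening Θ
  have hm : ContinuousOn m (cthickening δ Θ) := hR.r2.differentiable.continuousOn
  have hBΘ : identifiedBoundary Θ m ⊆ Θ := fun θ hθ => hθ.1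
  have hBm : ∀ θ ∈ identifiedBoundary Θ m, m θ = 0 := fun θ hθ => hθ.2
  have hBA : identifiedBoundary Θ m ⊆ identifiedSet Θ m := fun θ hθ => ⟨hθ.1, hθ.2.le⟩
  obtain ⟨X, Y, hX, hY, hYG, hXY⟩ := hR.r1.exists_limit
  have hLeq : ∀ η ∈ H, ∀ n ω, ∀ θ ∈ Θ,
      lrStatT (cthickening δ Θ) mhat shat η n ω θ = lrStat mhat shat n ω θ := fun η hη n ω θ hθ => by
    rw [lrStatT, lrStat, transformed_apply hη.1 _ (hΘD hθ)]
  have hinv : Invariant Θ H φL φLT := by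
    intro η hη θ hθ n ω
    have h1 : (fun ω (θ : Θ) => lrStatT (cthickening δ Θ) mhat shat η n ω θ) =
        fun ω (θ : Θ) => lrStat mhat shat n ω θ := by
      funext ω θ
      exact hLeq η hη n ω θ θ.2
    simp only [φL, φLT, decision, h1, hLeq η hη n ω θ hθ]
  have hid : id ∈ H := id_mem_admissibleTransformations hR
  have hmhat₀ : ∃ θ₀ ∈ Θ, Tendsto (fun p : ℕ × Ω => mhat p.1 p.2 θ₀) (inProb P) (𝓝 0) := by
    obtain ⟨θ₀, hθ₀⟩ := hB
    refine ⟨θ₀, hθ₀.1, Metric.tendsto_nhds.2 fun ε hε => ?_⟩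
    filter_upwards [hR.r1.eventually_abs_sub_lt hε] with p hp
    have := hp θ₀ (hΘD hθ₀.1)
    rwa [hθ₀.2] at this
  obtain ⟨θ₀, hθ₀, hmhat₀⟩ := hmhat₀
  have hWT0 : ∀ η, ∀ n ω θ, 0 ≤ waldStatT (cthickening δ Θ) mhat what η n ω θ := fun η n ω θ => sq_nonneg _
  have hshat : ∀ θ ∈ Θ, Tendsto (fun p : ℕ × Ω => shat p.1 p.2 θ) (inProb P) (𝓝 (s θ)) := by
    intro θ hθ
    rw [Metric.tendsto_nhds]
    intro ε hε
    filter_upwards [hR.r3_s.consistent.eventually hε] with p hp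
    exact hp θ (hΘD hθ)
  rw [← waldStatT_id (cthickening δ Θ)] at hkW
  refine ⟨hinv, fun hsd => ?_, fun b _ hform => ?_, fun hsd b hb => ?_⟩
  · have hsc : ContinuousOn s Θ := hR.r3_s.continuous.mono hΘD
    have hs0 : ∀ θ ∈ Θ, 0 < s θ := fun θ hθ => hR.r3_s.pos (hΘD hθ)
    have hratio : RatioApprox P Θ mhat (lrStat mhat shat) s :=
      (lrStat_ratioApprox hR.r3_s).mono hΘD
    have hL0 : ∀ n ω θ, 0 ≤ lrStat mhat shat n ω θ := fun n ω θ => sq_nonneg _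
    obtain ⟨hq, hk⟩ := tendsto_criticalValue hR.r1 hX hY hYG hXY hm hΘ hΘD hB hsc hs0 hratio hL0
      hBA subset_rfl hα0 hα hkL
    have hsim : AsymptoticallySimilar P (identifiedBoundary Θ m) φL :=
      asymptoticallySimilar_decision hR.r1 hΘ hΘD hsc hs0 hratio hL0 hq hk hBΘ hBm hsd
    refine ⟨hsim, fun η hη => ?_⟩
    obtain ⟨c, hc0, hc1, hc⟩ := hsim
    refine ⟨c, hc0, hc1, fun θ hθ => ?_⟩
    simpa only [hinv η hη θ (hBΘ hθ)] using hc θ hθ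
  · intro η hη θ₁ hθ₁ θseq hseq hlim
    obtain ⟨b₁, hb₁, hb₁0, hratio₁, hdiv₁, hw₁⟩ := exists_waldStatT_weight hΘ hid hθ₀ hmhat₀
    obtain ⟨b₂, hb₂, hb₂0, hratio₂, hdiv₂, hw₂⟩ := exists_waldStatT_weight hΘ hη hθ₀ hmhat₀
    have hbb : ∀ θ ∈ identifiedBoundary Θ m, b₁ θ = b₂ θ := fun θ hθ =>
      (hw₁ _ _ b hBΘ (hform id hid) (fun _ _ => tendsto_const_nhds) θ hθ).trans
        (hw₂ _ _ b hBΘ (hform η hη) (fun _ _ => tendsto_const_nhds) θ hθ).symm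
    obtain ⟨hq, hk₁⟩ := tendsto_criticalValue hR.r1 hX hY hYG hXY hm hΘ hΘD hB hb₁ hb₁0 hratio₁
      (hWT0 id) hBA subset_rfl hα0 hα hkW
    obtain ⟨-, hk₂⟩ := tendsto_criticalValue hR.r1 hX hY hYG hXY hm hΘ hΘD hB hb₂ hb₂0 hratio₂
      (hWT0 η) subset_rfl hBA hα0 hα (hkWT η hη)
    -- The two effective weights agree on the boundary, so both critical values have the same limit.
    simp only [← supScore_congr (D := cthickening δ Θ) hbb] at hk₂
    have hev := eventually_decision_eq hR.r1 hm hΘD hb₁ hb₁0 hb₂ hb₂0 hratio₁ hratio₂ hdiv₁ hdiv₂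
      (hWT0 id) (hWT0 η) hq hk₁ hk₂ hbb hθ₁ hseq hlim
    rw [waldStatT_id] at hev
    have heq : ∀ᶠ p in inProb P, φW p.1 p.2 (θseq p.1) = φWT η p.1 p.2 (θseq p.1) :=
      hev.mono fun p hp => by simp only [φW, φWT, decision, hp]
    exact eventually_inProb_iff.1 heq
  · have key : ∀ η ∈ H, HasWeightForm P (cthickening δ Θ) (identifiedBoundary Θ m) m what η
        (fun n ω θ => b * shat n ω θ) → ∀ (A : Set (EuclideanSpace ℝ (Fin d))) (k : ℕ → Ω → ℝ),
        identifiedBoundary Θ m ⊆ A → A ⊆ identifiedSet Θ m →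
        EstimatesAsymptoticQuantile P k (supStat A (waldStatT (cthickening δ Θ) mhat what η)) (1 - α) →
        AsymptoticallySimilar P (identifiedBoundary Θ m)
          (decision (waldStatT (cthickening δ Θ) mhat what η) k) := by
      intro η hη hform A k hBA hA hk
      obtain ⟨b', hb', hb'0, hratio, -, hw⟩ := exists_waldStatT_weight hΘ hη hθ₀ hmhat₀
      obtain ⟨hq, hk⟩ := tendsto_criticalValue hR.r1 hX hY hYG hXY hm hΘ hΘD hB hb' hb'0 hratio
        (hWT0 η) hBA hA hα0 hα hk
      refine asymptoticallySimilar_decision hR.r1 hΘ hΘD hb' hb'0 hratio (hWT0 η) hq hk hBΘ hBm ?_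
      obtain ⟨c, hc, hcs⟩ := hsd
      -- The effective weight on the boundary is b·s, where s is c times the standard deviation.
      refine ⟨b * c, mul_pos hb hc, fun θ hθ => ?_⟩
      rw [hw _ _ (fun θ => b * s θ) hBΘ hform
        (fun θ hθ => (hshat θ (hBΘ hθ)).const_mul b) θ hθ, hcs θ hθ, mul_assoc]
    refine ⟨fun hform => ?_, fun η hη hform => key η hη hform _ _ subset_rfl hBA (hkWT η hη)⟩
    have := key id hid hform _ _ hBA subset_rfl hkW
    rwa [waldStatT_id] at this
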